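/- For a finite group $G$ write $G'=[G,G]$ for its derived subgroup, and call $G$ ab-maximal if $|H:H'|<|G:G'|$ for every proper subgroup $H$ of $G$. (1) For every prime $p$ and every integer $n\ge 160$ there is a finite ab-maximal $p$-group $G$ with $|G:G'|=p^n$ and $|G'|=p^{n-3}$; if $p\neq 2$, then $G$ can moreover be taken to have exponent $p$. (2) Consequently, for every prime $p$, there are nonabelian finite ab-maximal $p$-groups $G$ of infinitely many different orders such that $|G:G'|=p^3|G'|$. (3) Consequently, there is no real number $\delta>1/2$ such that $|G:G'|\ge |G|^{\delta}$ for every finite ab-maximal group $G$. (This answers Question C of Lisi and Sabatini in the negative.) -/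

import Mathlib

/-- A group `G` (always assumed finite where this is used) is ab-maximal if
`|H : H'| < |G : G'|` for every proper subgroup `H` of `G`. Here `commutator H` is the derived
subgroup of `H`, as a subgroup of `H`. -/
def IsAbMaximal (G : Type*) [Group G] : Prop :=
  ∀ H : Subgroup G, H ≠ ⊤ → (commutator H).index < (commutator G).index

/-- An extremal ab-maximal `p`-group: a nonabelian ab-maximal `p`-group `G` such that
`|G : G'| = p ^ 3 * |G'|` (used only for finite `G`). -/
structure IsExtremalAbMaximal (p : ℕ) (G : Type*) [Group G] : Prop where
  isPGroup : IsPGroup p G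
  nonabelian : ¬ ∀ x y : G, x * y = y * x
  abMaximal : IsAbMaximal G
  index_eq : (commutator G).index = p ^ 3 * Nat.card (commutator G)

/-! The group is a central extension of V = F_p^n by W = F_p^(n-3) with a bilinear cocycle b.
Commutators are the values of the alternating map b(x,y) - b(y,x), so a subgroup H with projection U
satisfies |H : H'| ≤ |U| |W| / |S|, where S is the span of these values on U. It is enough that dim
S ≥ dim U - 2 for every proper U: the bound is then p^(n-1), while |G : G'| = p^n
(`TwistedProduct.isAbMaximal`). Since b need not be alternating, p = 2 is no exception.

Such a b exists by counting (`exists_finrank_le_finrank_skewSpan`). For dim U ≥ 4 a union bound over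
U and the subspaces that could contain S suffices (`ncard_deficientTuples_le`). For dim U = 3 the
n-3 component forms must not all be symmetric on U. The expected number of bad U is only bounded by
the constant 64/21, so a union bound fails.

Instead n-4 components are chosen first. By Markov's inequality, with positive probability they
leave at most (61/20) q^3 bad three-spaces (`ncard_large_isotropicThree_le`), and almost surely any
five of these are independent (`ncard_dependentTuples_le`). The last component is symmetric on k ≤ 5
given ones with probability exactly q^(-3k). This fixes five binomial moments, and a quintic sieve
polynomial shows that all of them are avoided with probability at least 1/672
(`card_le_mul_ncard_forall_notMem_symmOn`). Deficiency in dimension at least 4 is too rare to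
exhaust that proportion. -/

open Module

/-! ### Bilinear forms symmetric on prescribed subspaces -/

section Forms

variable {F V : Type*} [Field F] [AddCommGroup V] [Module F V]

/-- A linearly independent family has a dual family of functionals. -/
theorem LinearIndependent.exists_dual_family {ι : Type*} [DecidableEq ι] {z : ι → V}
    (hz : LinearIndependent F z) :
    ∃ ξ : ι → (V →ₗ[F] F), ∀ i j, ξ i (z j) = if i = j then 1 else 0 := by
  have h : ∀ i, ∃ g : V →ₗ[F] F, g ∘ₗ (Submodule.span F (Set.range z)).subtype =
      (Basis.span hz).coord i := fun i => LinearMap.exists_extend _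
  choose ξ hξ using h
  refine ⟨ξ, fun i j => ?_⟩
  have h1 := LinearMap.congr_fun (hξ i) (Basis.span hz j)
  have h2 : ((Basis.span hz j : Submodule.span F (Set.range z)) : V) = z j := by
    rw [Basis.span_apply hz j]
  simp only [LinearMap.comp_apply, Submodule.subtype_apply, h2, Basis.coord_apply,
    Basis.repr_self] at h1
  rw [h1, Finsupp.single_apply]
  simp [eq_comm]

/-- A bilinear form may be prescribed on a finite linearly independent family. -/
theorem LinearIndependent.exists_bilinForm {ι : Type*} [Fintype ι] {z : ι → V}
    (hz : LinearIndependent F z) (g : ι → ι → F) :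
    ∃ f : LinearMap.BilinForm F V, ∀ i j, f (z i) (z j) = g i j := by
  classical
  obtain ⟨ξ, hξ⟩ := hz.exists_dual_family
  refine ⟨∑ i, ∑ j, g i j • LinearMap.BilinForm.linMulLin (ξ i) (ξ j), fun a b => ?_⟩
  simp [LinearMap.sum_apply, LinearMap.BilinForm.linMulLin_apply, hξ]

/-- The bilinear forms whose restriction to `U` is symmetric. -/
def symmOn (U : Submodule F V) : Submodule F (LinearMap.BilinForm F V) where
  carrier := {f | ∀ x ∈ U, ∀ y ∈ U, f x y = f y x}
  add_mem' {f g} hf hg x hx y hy := by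
    simp [hf x hx y hy, hg x hx y hy]
  zero_mem' x _ y _ := by simp
  smul_mem' c f hf x hx y hy := by simp [hf x hx y hy]

theorem mem_symmOn {U : Submodule F V} {f : LinearMap.BilinForm F V} :
    f ∈ symmOn U ↔ ∀ x ∈ U, ∀ y ∈ U, f x y = f y x := Iff.rfl

theorem mem_symmOn_span {ι : Type*} {z : ι → V} {f : LinearMap.BilinForm F V} :
    f ∈ symmOn (Submodule.span F (Set.range z)) ↔ ∀ i j, f (z i) (z j) = f (z j) (z i) := by
  refine ⟨fun h i j => h _ (Submodule.subset_span ⟨i, rfl⟩) _ (Submodule.subset_span ⟨j, rfl⟩),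
    fun h x hx y hy => ?_⟩
  induction hx using Submodule.span_induction with
  | mem x hx =>
    obtain ⟨i, rfl⟩ := hx
    induction hy using Submodule.span_induction with
    | mem y hy => obtain ⟨j, rfl⟩ := hy; exact h i j
    | zero => simp
    | add a b _ _ ha hb => simp [ha, hb]
    | smul c a _ ha => simp [ha]
  | zero => simp
  | add a b _ _ ha hb => simp [ha, hb]
  | smul c a _ ha => simp [ha]

/-- The value of `f x y - f y x`, linearly in the form `f`. -/
def skewAt (x y : V) : LinearMap.BilinForm F V →ₗ[F] F where
  toFun f := f x y - f y x
  map_add' f g := by simp; ring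
  map_smul' c f := by simp; ring

@[simp] theorem skewAt_apply (x y : V) (f : LinearMap.BilinForm F V) :
    skewAt x y f = f x y - f y x := rfl

theorem finite_bilinForm [Finite F] [Finite V] : Finite (LinearMap.BilinForm F V) :=
  Finite.of_injective (fun (f : LinearMap.BilinForm F V) (a b : V) => f a b)
    fun _ _ h => LinearMap.ext₂ fun a b => congrFun (congrFun h a) b

/-- A subspace on which a linear map `φ` is onto has its cardinality divided by that of the target
on intersecting with a subspace of the kernel of `φ`. -/
theorem card_inf_mul_card_le {M N : Type*} [AddCommGroup M] [Module F M] [Finite M]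
    [AddCommGroup N] [Module F N] [Finite N] (Z K : Submodule F M) (φ : M →ₗ[F] N)
    (hK : K ≤ LinearMap.ker φ) (hφ : ∀ c, ∃ f ∈ Z, φ f = c) :
    Nat.card (Z ⊓ K : Submodule F M) * Nat.card N ≤ Nat.card Z := by
  choose s hs hφs using hφ
  rw [← Nat.card_prod]
  refine Nat.card_le_card_of_injective
    (fun a : (Z ⊓ K : Submodule F M) × N => (⟨a.1 + s a.2, Z.add_mem a.1.2.1 (hs _)⟩ : Z)) ?_
  rintro ⟨⟨f, hf⟩, c⟩ ⟨⟨g, hg⟩, d⟩ h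
  simp only [Subtype.mk.injEq] at h
  have h1 := congrArg φ h
  have hf0 : φ f = 0 := hK hf.2
  have hg0 : φ g = 0 := hK hg.2
  rw [map_add, map_add, hf0, hg0, hφs, hφs, zero_add, zero_add] at h1
  subst h1
  simpa using h

theorem card_ker_mul_card {M N : Type*} [AddCommGroup M] [Module F M]
    [AddCommGroup N] [Module F N] (φ : M →ₗ[F] N) (hφ : Function.Surjective φ) :
    Nat.card (LinearMap.ker φ) * Nat.card N = Nat.card M := by
  rw [Submodule.card_eq_card_quotient_mul_card (LinearMap.ker φ),
    Nat.card_congr (φ.quotKerEquivOfSurjective hφ).toEquiv]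

/-- The forms that are symmetric on each member of `T`. -/
def symmOnAll (T : Finset (Submodule F V)) : Submodule F (LinearMap.BilinForm F V) :=
  ⨅ U ∈ T, symmOn U

theorem mem_symmOnAll {T : Finset (Submodule F V)} {f : LinearMap.BilinForm F V} :
    f ∈ symmOnAll T ↔ ∀ U ∈ T, f ∈ symmOn U := by
  simp [symmOnAll]

variable [Module.Finite F V]

open Classical in
/-- A basis of a three-dimensional subspace. -/
noncomputable def frame (U : Submodule F V) : Fin 3 → V :=
  if h : finrank F U = 3 then fun i => (finBasisOfFinrankEq F U h i : V) else 0

theorem linearIndependent_frame {U : Submodule F V} (h : finrank F U = 3) :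
    LinearIndependent F (frame U) := by
  have := (finBasisOfFinrankEq F U h).linearIndependent.map' U.subtype (by simp)
  simpa [frame, h, Function.comp_def] using this

theorem span_frame {U : Submodule F V} (h : finrank F U = 3) :
    Submodule.span F (Set.range (frame U)) = U := by
  have h1 : frame U = U.subtype ∘ finBasisOfFinrankEq F U h := by
    ext i; simp [frame, h]
  rw [h1, Set.range_comp, ← Submodule.map_span, Basis.span_eq, Submodule.map_top,
    Submodule.range_subtype]

/-- The union of the frames of the members of `T` is linearly independent. -/
def FrameIndep (T : Finset (Submodule F V)) : Prop :=
  LinearIndependent F (fun a : T × Fin 3 => frame a.1.1 a.2)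

/-- The default value 0 of `frame` destroys independence, so `FrameIndep` carries the dimension
condition with it. -/
theorem FrameIndep.finrank_eq {T : Finset (Submodule F V)} (hT : FrameIndep T)
    {U : Submodule F V} (hU : U ∈ T) : finrank F U = 3 := by
  by_contra h
  exact hT.ne_zero (⟨U, hU⟩, 0) (by simp [frame, h])

/-- The span of the members of `T`. -/
def frameSpan (T : Finset (Submodule F V)) : Submodule F V :=
  Submodule.span F (Set.range (fun a : T × Fin 3 => frame a.1.1 a.2))

/-- Symmetry on independent three-dimensional subspaces is the vanishing of independent
coordinates, three for each subspace. -/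
theorem card_symmOnAll [Finite F] [Finite V] {T : Finset (Submodule F V)} (hT : FrameIndep T) :
    Nat.card (symmOnAll T) * (Nat.card F ^ 3) ^ T.card =
      Nat.card (LinearMap.BilinForm F V) := by
  classical
  let φ : LinearMap.BilinForm F V →ₗ[F] (T → Fin 3 → F) :=
    LinearMap.pi fun U => LinearMap.pi fun k =>
      -- The index k runs through the pairs (0,1), (0,2), (1,2).
      skewAt (frame U.1 (![0, 0, 1] k)) (frame U.1 (![1, 2, 2] k))
  have hker : LinearMap.ker φ = symmOnAll T := by
    ext f
    rw [LinearMap.mem_ker, mem_symmOnAll]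
    constructor
    · intro h U hU
      have h3 : ∀ k, φ f ⟨U, hU⟩ k = 0 := fun k => by rw [h]; rfl
      have e0 := h3 0
      have e1 := h3 1
      have e2 := h3 2
      simp only [φ, LinearMap.pi_apply, skewAt_apply, sub_eq_zero] at e0 e1 e2
      simp at e0 e1 e2
      rw [← span_frame (hT.finrank_eq hU), mem_symmOn_span]
      intro i j
      fin_cases i <;> fin_cases j <;> simp [e0, e1, e2]
    · intro h
      ext U k
      have h1 := h U.1 U.2
      rw [← span_frame (hT.finrank_eq U.2), mem_symmOn_span] at h1
      simp [φ, h1 (![0, 0, 1] k) (![1, 2, 2] k)]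
  have hsurj : Function.Surjective φ := by
    intro c
    obtain ⟨f, hf⟩ := LinearIndependent.exists_bilinForm hT
      (fun a b => if a.1 = b.1 then
        (if a.2 = 0 ∧ b.2 = 1 then c a.1 0 else if a.2 = 0 ∧ b.2 = 2 then c a.1 1
          else if a.2 = 1 ∧ b.2 = 2 then c a.1 2 else 0) else 0)
    refine ⟨f, ?_⟩
    ext U k
    have h1 := hf (U, ![0, 0, 1] k) (U, ![1, 2, 2] k)
    have h2 := hf (U, ![1, 2, 2] k) (U, ![0, 0, 1] k)
    simp only [φ, LinearMap.pi_apply, skewAt_apply]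
    simp only at h1 h2
    rw [h1, h2]
    fin_cases k <;> simp
  have := card_ker_mul_card (F := F) (M := LinearMap.BilinForm F V) φ hsurj
  rw [hker] at this
  rw [← this, Nat.card_fun, Nat.card_fun]
  simp

/-- The forms that are symmetric on the independent members of `T` and on a further subspace
meeting their span in a line. -/
theorem card_symmOnAll_inf_one [Finite F] [Finite V] {T : Finset (Submodule F V)}
    {a y z : V} (ha : a ∈ frameSpan T)
    (hT : FrameIndep T) (hay : LinearIndependent F ![a, y, z])
    (hyz : LinearIndependent F
      (Sum.elim (fun a : T × Fin 3 => frame a.1.1 a.2) ![y, z])) {U : Submodule F V}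
    (haU : a ∈ U) (hyU : y ∈ U) (hzU : z ∈ U) :
    Nat.card (symmOnAll T ⊓ symmOn U : Submodule F (LinearMap.BilinForm F V)) * Nat.card F ^ 3 ≤
      Nat.card (symmOnAll T) := by
  classical
  obtain ⟨ξ, hξ⟩ := hay.exists_dual_family
  obtain ⟨η, hη⟩ := hyz.exists_dual_family
  set ℓ := ξ 0 with hℓ
  set m₀ := η (Sum.inr 0) with hm₀
  set m₁ := η (Sum.inr 1) with hm₁
  have hS : ∀ i : Fin 2, ∀ s ∈ frameSpan T, η (Sum.inr i) s = 0 := by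
    intro i s hs
    have : frameSpan T ≤ LinearMap.ker (η (Sum.inr i)) := by
      rw [frameSpan, Submodule.span_le]
      rintro _ ⟨b, rfl⟩
      have := hη (Sum.inr i) (Sum.inl b)
      simpa using this
    exact this hs
  have hl0 : ℓ a = 1 := by simpa using hξ 0 0
  have hl1 : ℓ y = 0 := by simpa using hξ 0 1
  have hl2 : ℓ z = 0 := by simpa using hξ 0 2
  have h00 : m₀ y = 1 := by simpa using hη (Sum.inr 0) (Sum.inr 0)
  have h01 : m₀ z = 0 := by simpa using hη (Sum.inr 0) (Sum.inr 1)
  have h10 : m₁ y = 0 := by simpa using hη (Sum.inr 1) (Sum.inr 0)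
  have h11 : m₁ z = 1 := by simpa using hη (Sum.inr 1) (Sum.inr 1)
  have h0a : m₀ a = 0 := hS 0 a ha
  have h1a : m₁ a = 0 := hS 1 a ha
  let φ : LinearMap.BilinForm F V →ₗ[F] (Fin 3 → F) :=
    LinearMap.pi ![skewAt a y, skewAt a z, skewAt y z]
  have := finite_bilinForm (F := F) (V := V)
  have := card_inf_mul_card_le (F := F) (M := LinearMap.BilinForm F V) (symmOnAll T) (symmOn U) φ ?_ ?_
  · simpa [Nat.card_fun] using this
  · intro f hf
    rw [LinearMap.mem_ker]
    ext k
    fin_cases k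
    · simpa [φ, sub_eq_zero] using hf a haU y hyU
    · simpa [φ, sub_eq_zero] using hf a haU z hzU
    · simpa [φ, sub_eq_zero] using hf y hyU z hzU
  · intro c
    -- Each product has a factor that kills the span of `T`, so it vanishes on every member of `T`
    -- and leaves the three skew values on a, y, z free.
    refine ⟨c 0 • LinearMap.BilinForm.linMulLin ℓ m₀ + c 1 • LinearMap.BilinForm.linMulLin ℓ m₁ +
      c 2 • LinearMap.BilinForm.linMulLin m₀ m₁, ?_, ?_⟩
    · rw [mem_symmOnAll]
      intro W hW
      rw [← span_frame (hT.finrank_eq hW), mem_symmOn_span]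
      intro i j
      have hs : ∀ i, frame W i ∈ frameSpan T := fun i =>
        Submodule.subset_span ⟨(⟨W, hW⟩, i), rfl⟩
      simp [hm₀, hm₁, hS 0 _ (hs i), hS 1 _ (hs i), hS 0 _ (hs j), hS 1 _ (hs j)]
    · ext k
      fin_cases k <;> simp [φ, hl0, hl1, hl2, h00, h01, h10, h11, h0a, h1a]

/-- The forms that are symmetric on the independent members of `T` and on a further subspace
meeting their span in a plane. -/
theorem card_symmOnAll_inf_two [Finite F] [Finite V] {T : Finset (Submodule F V)}
    {a b y : V} (ha : a ∈ frameSpan T) (hb : b ∈ frameSpan T)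
    (hT : FrameIndep T) (hab : LinearIndependent F ![a, b, y])
    (hy : LinearIndependent F
      (Sum.elim (fun a : T × Fin 3 => frame a.1.1 a.2) ![y])) {U : Submodule F V}
    (haU : a ∈ U) (hbU : b ∈ U) (hyU : y ∈ U) :
    Nat.card (symmOnAll T ⊓ symmOn U : Submodule F (LinearMap.BilinForm F V)) * Nat.card F ^ 2 ≤
      Nat.card (symmOnAll T) := by
  classical
  obtain ⟨ξ, hξ⟩ := hab.exists_dual_family
  obtain ⟨η, hη⟩ := hy.exists_dual_family
  set ℓ₀ := ξ 0 with hℓ₀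
  set ℓ₁ := ξ 1 with hℓ₁
  set m := η (Sum.inr 0) with hm
  have hS : ∀ s ∈ frameSpan T, m s = 0 := by
    intro s hs
    have : frameSpan T ≤ LinearMap.ker m := by
      rw [frameSpan, Submodule.span_le]
      rintro _ ⟨b, rfl⟩
      have := hη (Sum.inr 0) (Sum.inl b)
      simpa using this
    exact this hs
  have h00 : ℓ₀ a = 1 := by simpa using hξ 0 0
  have h01 : ℓ₀ b = 0 := by simpa using hξ 0 1
  have h02 : ℓ₀ y = 0 := by simpa using hξ 0 2
  have h10 : ℓ₁ a = 0 := by simpa using hξ 1 0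
  have h11 : ℓ₁ b = 1 := by simpa using hξ 1 1
  have h12 : ℓ₁ y = 0 := by simpa using hξ 1 2
  have hmy : m y = 1 := by simpa using hη (Sum.inr 0) (Sum.inr 0)
  have hma : m a = 0 := hS a ha
  have hmb : m b = 0 := hS b hb
  let φ : LinearMap.BilinForm F V →ₗ[F] (Fin 2 → F) :=
    LinearMap.pi ![skewAt a y, skewAt b y]
  have := finite_bilinForm (F := F) (V := V)
  have := card_inf_mul_card_le (F := F) (M := LinearMap.BilinForm F V) (symmOnAll T) (symmOn U) φ ?_ ?_
  · simpa [Nat.card_fun] using this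
  · intro f hf
    rw [LinearMap.mem_ker]
    ext k
    fin_cases k
    · simpa [φ, sub_eq_zero] using hf a haU y hyU
    · simpa [φ, sub_eq_zero] using hf b hbU y hyU
  · intro c
    -- Only the pairs involving y can be adjusted by forms vanishing on the span of `T`; the pair
    -- (a, b) lies inside it and is not used.
    refine ⟨c 0 • LinearMap.BilinForm.linMulLin ℓ₀ m + c 1 • LinearMap.BilinForm.linMulLin ℓ₁ m,
      ?_, ?_⟩
    · rw [mem_symmOnAll]
      intro W hW
      rw [← span_frame (hT.finrank_eq hW), mem_symmOn_span]
      intro i j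
      have hs : ∀ i, frame W i ∈ frameSpan T := fun i =>
        Submodule.subset_span ⟨(⟨W, hW⟩, i), rfl⟩
      simp [hS _ (hs i), hS _ (hs j)]
    · ext k
      fin_cases k <;> simp [φ, h00, h01, h02, h10, h11, h12, hmy, hma, hmb]

end Forms

/-! ### How a further subspace meets an independent configuration -/

section Configurations

variable {F V : Type*} [Field F] [AddCommGroup V] [Module F V] [Module.Finite F V]

/-- Every three-dimensional subspace of the span of independent ones that is not one of them is
separated from them by a form. -/
theorem exists_mem_symmOnAll_notMem_symmOn {T : Finset (Submodule F V)} (hT : FrameIndep T)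
    {U : Submodule F V} (hU : finrank F U = 3) (hUS : U ≤ frameSpan T) (hUT : U ∉ T) :
    ∃ f ∈ symmOnAll T, f ∉ symmOn U := by
  classical
  by_contra! hall
  obtain ⟨ξ, hξ⟩ := LinearIndependent.exists_dual_family hT
  -- A product of coordinates from different blocks vanishes on each member of `T`. Its symmetry on
  -- `U` makes the two coordinates proportional there.
  have hrel : ∀ A B : T × Fin 3, A.1 ≠ B.1 → ∀ u ∈ U, ∀ v ∈ U, ξ A u * ξ B v = ξ A v * ξ B u := by
    intro A B hAB u hu v hv
    have hmem : LinearMap.BilinForm.linMulLin (ξ A) (ξ B) ∈ symmOnAll T := by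
      rw [mem_symmOnAll]
      intro W hW
      rw [← span_frame (hT.finrank_eq hW), mem_symmOn_span]
      intro i j
      have h1 := fun i => hξ A (⟨W, hW⟩, i)
      have h2 := fun i => hξ B (⟨W, hW⟩, i)
      simp only at h1 h2
      rw [LinearMap.BilinForm.linMulLin_apply, LinearMap.BilinForm.linMulLin_apply, h1, h2, h1, h2]
      by_cases hA : A.1 = ⟨W, hW⟩
      · have hB : ∀ i, B ≠ (⟨W, hW⟩, i) := fun i h => hAB (hA.trans (congrArg Prod.fst h).symm)
        simp [hB]
      · have hA' : ∀ i, A ≠ (⟨W, hW⟩, i) := fun i h => hA (congrArg Prod.fst h)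
        simp [hA']
    exact hall _ hmem u hu v hv
  have hexp : ∀ u ∈ frameSpan T, u = ∑ A : T × Fin 3, ξ A u • frame A.1.1 A.2 := by
    intro u hu
    obtain ⟨c, hc⟩ := (Submodule.mem_span_range_iff_exists_fun F).1 hu
    have : ∀ A, ξ A u = c A := by
      intro A
      rw [← hc, map_sum]
      simp [hξ]
    simp_rw [this]
    exact hc.symm
  have hinj : ∀ P : T, (∃ v ∈ U, ∃ k, ξ (P, k) v ≠ 0) → ∀ u ∈ U, (∀ k, ξ (P, k) u = 0) → u = 0 := by
    rintro P ⟨v, hv, k, hk⟩ u hu h0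
    rw [hexp u (hUS hu)]
    refine Finset.sum_eq_zero fun B _ => ?_
    suffices ξ B u = 0 by simp [this]
    obtain ⟨R, l⟩ := B
    by_cases hPR : P = R
    · subst hPR; exact h0 l
    · have := hrel (P, k) (R, l) hPR u hu v hv
      rw [h0, zero_mul] at this
      exact (mul_eq_zero.1 this.symm).resolve_left hk
  have hpos : ∃ u₀ ∈ U, u₀ ≠ 0 := by
    by_contra! h
    have : U = ⊥ := by rw [Submodule.eq_bot_iff]; exact h
    rw [this, finrank_bot] at hU
    omega
  obtain ⟨v, hv, hv0⟩ := hpos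
  obtain ⟨P, k, hPk⟩ : ∃ P k, ξ (P, k) v ≠ 0 := by
    by_contra! h
    exact hv0 (by rw [hexp v (hUS hv)]; exact Finset.sum_eq_zero fun B _ => by simp [h])
  -- If `U` involved only the block `P`, it would equal `P` by dimension.
  obtain ⟨R, hRP, hR⟩ : ∃ R : T, R ≠ P ∧ ∃ w ∈ U, ∃ l, ξ (R, l) w ≠ 0 := by
    by_contra! h
    have hle : U ≤ P.1 := by
      intro u hu
      rw [hexp u (hUS hu)]
      refine Submodule.sum_mem _ fun B _ => ?_
      obtain ⟨R, l⟩ := B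
      by_cases hRP : R = P
      · subst hRP
        refine Submodule.smul_mem _ _ ?_
        have : frame R.1 l ∈ Submodule.span F (Set.range (frame R.1)) :=
          Submodule.subset_span (Set.mem_range_self l)
        rwa [span_frame (hT.finrank_eq R.2)] at this
      · simp [h R hRP u hu l]
    have : U = P.1 := Submodule.eq_of_le_of_finrank_eq hle (by rw [hU, hT.finrank_eq P.2])
    exact hUT (this ▸ P.2)
  -- A nonzero u in `U` on which one `P`-coordinate vanishes has, by proportionality, no
  -- `R`-coordinates, and `hinj` then forces u = 0.
  have hker : LinearMap.ker ((ξ (P, k)).comp U.subtype) ≠ ⊥ :=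
    LinearMap.ker_ne_bot_of_finrank_lt (by rw [hU, finrank_self]; norm_num)
  obtain ⟨⟨u, hu⟩, huk, hu0⟩ := (Submodule.ne_bot_iff _).1 hker
  have huk' : ξ (P, k) u = 0 := by simpa using huk
  refine hu0 (Subtype.ext (hinj R hR u hu fun l => ?_))
  have := hrel (P, k) (R, l) hRP.symm u hu v hv
  rw [huk', zero_mul] at this
  exact (mul_eq_zero.1 this.symm).resolve_left hPk

/-- A basis of `U` adapted to its intersection with `S`. -/
theorem exists_adapted_basis (U S : Submodule F V) {d c : ℕ}
    (hd : finrank F (U ⊓ S : Submodule F V) = d) (hU : finrank F U = d + c) :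
    ∃ (a : Fin d → V) (y : Fin c → V), LinearIndependent F (Sum.elim a y) ∧
      Submodule.span F (Set.range (Sum.elim a y)) = U ∧ (∀ i, a i ∈ S) ∧
      LinearIndependent F y ∧ Disjoint S (Submodule.span F (Set.range y)) := by
  obtain ⟨C, hC, hsup, hdis⟩ : ∃ C : Submodule F V, C ≤ U ∧ (U ⊓ S) ⊔ C = U ∧
      Disjoint (U ⊓ S) C := by
    obtain ⟨C, hC⟩ := exists_isCompl (U ⊓ S)
    refine ⟨C ⊓ U, inf_le_right, ?_, hC.disjoint.mono_right inf_le_left⟩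
    rw [← sup_inf_assoc_of_le _ inf_le_left, hC.sup_eq_top, top_inf_eq]
  have hCc : finrank F C = c := by
    have h1 := Submodule.finrank_sup_add_finrank_inf_eq (U ⊓ S) C
    rw [hsup, hdis.eq_bot, finrank_bot] at h1
    omega
  let bD := finBasisOfFinrankEq F _ hd
  let bC := finBasisOfFinrankEq F _ hCc
  have sD : Submodule.span F (Set.range fun i => (bD i : V)) = U ⊓ S := by
    rw [show (fun i => (bD i : V)) = (U ⊓ S).subtype ∘ bD from rfl, Set.range_comp,
      ← Submodule.map_span, Basis.span_eq, Submodule.map_top, Submodule.range_subtype]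
  have sC : Submodule.span F (Set.range fun i => (bC i : V)) = C := by
    rw [show (fun i => (bC i : V)) = C.subtype ∘ bC from rfl, Set.range_comp,
      ← Submodule.map_span, Basis.span_eq, Submodule.map_top, Submodule.range_subtype]
  have lD : LinearIndependent F fun i => (bD i : V) :=
    bD.linearIndependent.map' (U ⊓ S).subtype (by simp)
  have lC : LinearIndependent F fun i => (bC i : V) :=
    bC.linearIndependent.map' C.subtype (by simp)
  refine ⟨fun i => bD i, fun i => bC i, lD.sum_type lC (by rwa [sD, sC]), ?_,
    fun i => (bD i).2.2, lC, ?_⟩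
  · rw [Set.Sum.elim_range, Submodule.span_union, sD, sC, hsup]
  · rw [sC, Submodule.disjoint_def]
    intro x hxS hxC
    exact (Submodule.disjoint_def.1 hdis) x ⟨hC hxC, hxS⟩ hxC

variable [Finite F] [Finite V]

theorem card_symmOnAll_inf_three {T : Finset (Submodule F V)} (hT : FrameIndep T)
    {U : Submodule F V} (hU : finrank F U = 3) (hUS : U ≤ frameSpan T) (hUT : U ∉ T) :
    Nat.card (symmOnAll T ⊓ symmOn U : Submodule F (LinearMap.BilinForm F V)) * Nat.card F ≤
      Nat.card (symmOnAll T) := by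
  obtain ⟨f, hfT, hfU⟩ := exists_mem_symmOnAll_notMem_symmOn hT hU hUS hUT
  rw [mem_symmOn] at hfU
  push Not at hfU
  obtain ⟨x, hx, y, hy, hxy⟩ := hfU
  have := finite_bilinForm (F := F) (V := V)
  refine card_inf_mul_card_le (F := F) (M := LinearMap.BilinForm F V) _ _ (skewAt x y) ?_ ?_
  · intro g hg
    simpa [sub_eq_zero] using hg x hx y hy
  · intro c
    refine ⟨(c / (f x y - f y x)) • f, Submodule.smul_mem _ _ hfT, ?_⟩
    rw [map_smul, skewAt_apply, smul_eq_mul, div_mul_cancel₀ _ (sub_ne_zero.2 hxy)]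

/-- Imposing symmetry on one more subspace costs more conditions the less it meets the span of the
previous ones. -/
theorem card_symmOnAll_inf {T : Finset (Submodule F V)} (hT : FrameIndep T)
    {U : Submodule F V} (hU : finrank F U = 3) (hUT : U ∉ T) {d : ℕ} (hd0 : d ≠ 0)
    (hd : finrank F (U ⊓ frameSpan T : Submodule F V) = d) :
    Nat.card (symmOnAll T ⊓ symmOn U : Submodule F (LinearMap.BilinForm F V)) *
      Nat.card F ^ (4 - d) ≤ Nat.card (symmOnAll T) := by
  have hd3 : d ≤ 3 := by
    rw [← hd, ← hU]; exact Submodule.finrank_mono inf_le_left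
  obtain rfl | rfl | rfl : d = 1 ∨ d = 2 ∨ d = 3 := by omega
  · obtain ⟨a, y, hay, hspan, haS, hy, hdis⟩ := exists_adapted_basis U (frameSpan T) (c := 2) hd (by rw [hU])
    have hmem : ∀ i, Sum.elim a y i ∈ U := fun i =>
      hspan ▸ Submodule.subset_span (Set.mem_range_self i)
    refine card_symmOnAll_inf_one (a := a 0) (y := y 0) (z := y 1) (haS 0) hT ?_ ?_
      (hmem (.inl 0)) (hmem (.inr 0)) (hmem (.inr 1))
    · rw [show ![a 0, y 0, y 1] = Sum.elim a y ∘ ![.inl 0, .inr 0, .inr 1] by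
        ext i; fin_cases i <;> rfl]
      exact hay.comp _ (by decide)
    · rw [show ![y 0, y 1] = y by ext i; fin_cases i <;> rfl]
      exact hT.sum_type hy hdis
  · obtain ⟨a, y, hay, hspan, haS, hy, hdis⟩ := exists_adapted_basis U (frameSpan T) (c := 1) hd (by rw [hU])
    have hmem : ∀ i, Sum.elim a y i ∈ U := fun i =>
      hspan ▸ Submodule.subset_span (Set.mem_range_self i)
    refine card_symmOnAll_inf_two (a := a 0) (b := a 1) (y := y 0) (haS 0) (haS 1) hT ?_ ?_
      (hmem (.inl 0)) (hmem (.inl 1)) (hmem (.inr 0))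
    · rw [show ![a 0, a 1, y 0] = Sum.elim a y ∘ ![.inl 0, .inl 1, .inr 0] by
        ext i; fin_cases i <;> rfl]
      exact hay.comp _ (by decide)
    · rw [show ![y 0] = y by ext i; fin_cases i; rfl]
      exact hT.sum_type hy hdis
  · have hle : U ≤ frameSpan T := by
      rw [← inf_eq_left]
      exact Submodule.eq_of_le_of_finrank_eq inf_le_left (by rw [hd, hU])
    simpa using card_symmOnAll_inf_three hT hU hle hUT

omit [Finite F] [Finite V] in
/-- A subspace disjoint from the span of an independent collection extends it. -/
theorem FrameIndep.insert [DecidableEq (Submodule F V)] {T : Finset (Submodule F V)}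
    (hT : FrameIndep T) {U : Submodule F V}
    (hU : finrank F U = 3) (hd : finrank F (U ⊓ frameSpan T : Submodule F V) = 0) :
    FrameIndep (insert U T) := by
  classical
  have hdis : Disjoint (frameSpan T) (Submodule.span F (Set.range (frame U))) := by
    rw [span_frame hU, disjoint_comm, disjoint_iff]
    exact Submodule.finrank_eq_zero.1 hd
  have hli := LinearIndependent.sum_type hT (linearIndependent_frame hU) hdis
  let r : {W // W ∈ Insert.insert U T} × Fin 3 → (T × Fin 3) ⊕ Fin 3 := fun a =>
    if h : a.1.1 ∈ T then .inl (⟨a.1.1, h⟩, a.2) else .inr a.2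
  have hr : Function.Injective r := by
    rintro ⟨⟨A, hA⟩, i⟩ ⟨⟨B, hB⟩, j⟩ h
    by_cases h1 : A ∈ T <;> by_cases h2 : B ∈ T <;> simp [r, h1, h2] at h ⊢
    · exact h
    · rw [Finset.mem_insert] at hA hB
      exact ⟨(hA.resolve_right h1).trans (hB.resolve_right h2).symm, h⟩
  have heq : (fun a : {W // W ∈ Insert.insert U T} × Fin 3 => frame a.1.1 a.2) =
      Sum.elim (fun a : T × Fin 3 => frame a.1.1 a.2) (frame U) ∘ r := by
    ext ⟨⟨A, hA⟩, i⟩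
    by_cases h1 : A ∈ T
    · simp [r, h1]
    · have : A = U := (Finset.mem_insert.1 hA).resolve_right h1
      subst this
      simp [r, h1]
  rw [FrameIndep, heq]
  exact hli.comp r hr

omit [Finite V] in
theorem card_frameSpan_le (T : Finset (Submodule F V)) :
    Nat.card (frameSpan T) ≤ Nat.card F ^ (3 * T.card) := by
  rw [Module.natCard_eq_pow_finrank (K := F)]
  refine Nat.pow_le_pow_right Nat.card_pos ?_
  refine (finrank_range_le_card _).trans ?_
  simp [mul_comm]

omit [Finite F] in
/-- Counting three-dimensional subspaces by their intersection with a given subspace. -/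
theorem card_finrank_inf_eq_le (S : Submodule F V) {d : ℕ} (hd3 : d ≤ 3) :
    Nat.card {U : Submodule F V // finrank F U = 3 ∧ finrank F (U ⊓ S : Submodule F V) = d} ≤
      Nat.card S ^ d * Nat.card V ^ (3 - d) := by
  -- An adapted basis, with d vectors in `S` and 3 - d in `V`, determines `U`.
  have h : ∀ U : {U : Submodule F V // finrank F U = 3 ∧ finrank F (U ⊓ S : Submodule F V) = d},
      ∃ a : (Fin d → S) × (Fin (3 - d) → V),
        Submodule.span F (Set.range (Sum.elim (fun i => (a.1 i : V)) a.2)) = U.1 := by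
    rintro ⟨U, hU, hd⟩
    obtain ⟨a, y, -, hspan, haS, -⟩ := exists_adapted_basis U S (c := 3 - d) hd (by omega)
    exact ⟨(fun i => ⟨a i, haS i⟩, y), hspan⟩
  choose g hg using h
  have := Nat.card_le_card_of_injective g fun A B hAB => Subtype.ext (by rw [← hg A, ← hg B, hAB])
  simpa [Nat.card_prod, Nat.card_fun] using this

end Configurations

/-! ### The sieve polynomial -/

section Moments

/-- The polynomial `-(y-1)(y-3)(y-4)(y-7)(y-8)/672` in the basis of binomial coefficients. -/
noncomputable def sieveCoeff : Fin 6 → ℝ := ![1, -1, 51 / 56, -41 / 56, 13 / 28, -5 / 28]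

theorem cast_choose_succ_mul (y k : ℕ) :
    (y.choose (k + 1) : ℝ) * (k + 1) = y.choose k * ((y : ℝ) - k) := by
  rcases le_or_gt k y with h | h
  · have := Nat.choose_succ_right_eq y k
    rw [← Nat.cast_sub h]
    exact_mod_cast this
  · simp [Nat.choose_eq_zero_of_lt h, Nat.choose_eq_zero_of_lt (h.trans (Nat.lt_succ_self k))]

theorem cast_choose_eqs (y : ℕ) :
    (y.choose 0 : ℝ) = 1 ∧ (y.choose 1 : ℝ) = y ∧ (y.choose 2 : ℝ) = y * (y - 1) / 2 ∧
    (y.choose 3 : ℝ) = y * (y - 1) * (y - 2) / 6 ∧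
    (y.choose 4 : ℝ) = y * (y - 1) * (y - 2) * (y - 3) / 24 ∧
    (y.choose 5 : ℝ) = y * (y - 1) * (y - 2) * (y - 3) * (y - 4) / 120 := by
  have h1 := cast_choose_succ_mul y 1
  have h2 := cast_choose_succ_mul y 2
  have h3 := cast_choose_succ_mul y 3
  have h4 := cast_choose_succ_mul y 4
  norm_num at h1 h2 h3 h4 ⊢
  have e2 : (y.choose 2 : ℝ) = y * (y - 1) / 2 := by linarith
  have e3 : (y.choose 3 : ℝ) = y * (y - 1) * (y - 2) / 6 := by rw [e2] at h2; linarith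
  have e4 : (y.choose 4 : ℝ) = y * (y - 1) * (y - 2) * (y - 3) / 24 := by rw [e3] at h3; linarith
  have e5 : (y.choose 5 : ℝ) = y * (y - 1) * (y - 2) * (y - 3) * (y - 4) / 120 := by
    rw [e4] at h4; linarith
  exact ⟨e2, e3, e4, e5⟩

/-- The roots 3, 4 and 7, 8 are pairs of consecutive integers, so each pair of factors has a
nonnegative product at every integer. The root 1 fixes the sign for y ≥ 1, and 672 = 1·3·4·7·8
normalises the value at 0. -/
theorem sum_sieveCoeff_choose_le (y : ℕ) :
    ∑ k : Fin 6, sieveCoeff k * (y.choose k : ℝ) ≤ if y = 0 then 1 else 0 := by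
  obtain ⟨e0, e1, e2, e3, e4, e5⟩ := cast_choose_eqs y
  have hsum : ∑ k : Fin 6, sieveCoeff k * (y.choose k : ℝ) =
      -(((y : ℝ) - 1) * ((y - 3) * (y - 4)) * ((y - 7) * (y - 8))) / 672 := by
    simp only [Fin.sum_univ_six, sieveCoeff]
    simp only [Fin.isValue, Matrix.cons_val, Fin.val_zero, Fin.val_one, Fin.val_two,
      show ((3 : Fin 6) : ℕ) = 3 from rfl, show ((4 : Fin 6) : ℕ) = 4 from rfl,
      show ((5 : Fin 6) : ℕ) = 5 from rfl, e0, e1, e2, e3, e4, e5]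
    ring
  rw [hsum]
  split_ifs with h
  · subst h; norm_num
  · have hc : ∀ a : ℕ, 0 ≤ ((y : ℝ) - a) * (y - (a + 1)) := by
      intro a
      rcases le_or_gt y a with h | h
      · have : (y : ℝ) ≤ a := by exact_mod_cast h
        nlinarith
      · have : (a : ℝ) + 1 ≤ y := by exact_mod_cast h
        nlinarith
    have h3 := hc 3
    have h7 := hc 7
    have h1 : (0 : ℝ) ≤ (y : ℝ) - 1 := by
      have : 1 ≤ y := Nat.one_le_iff_ne_zero.2 h
      rw [sub_nonneg]; exact_mod_cast this
    norm_num at h3 h7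
    have := mul_nonneg (mul_nonneg h1 h3) h7
    linarith

/-- With X subspaces, x = X/q^3 and e = 1/q^3, the terms are `sieveCoeff` times X.choose k / q^(3k),
so this bounds the mean of the sieve polynomial. Plain inclusion-exclusion cut off after five terms
would already be negative at x = 61/20, e = 0. -/
theorem sieve_polynomial_ge {x e : ℝ} (hx0 : 0 ≤ x) (hx : x ≤ 61 / 20) (he0 : 0 ≤ e)
    (he : e ≤ 1 / 8) :
    1 / 672 ≤ 1 - x + 51 / 56 * (x * (x - e) / 2) - 41 / 56 * (x * (x - e) * (x - 2 * e) / 6) +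
      13 / 28 * (x * (x - e) * (x - 2 * e) * (x - 3 * e) / 24) -
      5 / 28 * (x * (x - e) * (x - 2 * e) * (x - 3 * e) * (x - 4 * e) / 120) := by
  -- Recentring just beyond the endpoint 61/20 keeps s positive; the products below form a
  -- positivity certificate in s and e.
  obtain ⟨s, rfl⟩ : ∃ s, x = 31 / 10 - s := ⟨31 / 10 - x, by ring⟩
  have hs : 1 / 20 ≤ s := by linarith
  have hs3 : s ≤ 31 / 10 := by linarith
  have hs0 : 0 ≤ s := by linarith
  have a1 : 0 ≤ s ^ 3 * (15 - 2.5 * s + s ^ 2) :=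
    mul_nonneg (by positivity) (by nlinarith [sq_nonneg (s - 1.25)])
  have a2 : 0 ≤ s * (3.3 - 4.93 * s + 1.89 * s ^ 2) := by
    refine mul_nonneg hs0 ?_
    nlinarith [sq_nonneg (s - 1.3)]
  have b0 : 0 ≤ e * (1 / 8 - e) := mul_nonneg he0 (by linarith)
  have b1 : 0 ≤ e ^ 3 * (1 / 8 - e) := mul_nonneg (by positivity) (by linarith)
  have b2 : 0 ≤ s * (e * (1 / 8 - e)) := mul_nonneg hs0 b0
  have b3 : 0 ≤ s * (e ^ 2 * (1 / 8 - e)) := mul_nonneg hs0 (mul_nonneg (by positivity) (by linarith))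
  have b4 : 0 ≤ s ^ 2 * (e * (1 / 8 - e)) := mul_nonneg (by positivity) b0
  have b5 : 0 ≤ s ^ 2 * e * (74 - 46 * s + 10 * s ^ 2) :=
    mul_nonneg (by positivity) (by nlinarith [sq_nonneg (s - 2.3)])
  have c1 : 0 ≤ s ^ 3 * e ^ 2 := by positivity
  have c2 : 0 ≤ s ^ 2 * e ^ 3 := by positivity
  have c3 : 0 ≤ s * e ^ 4 := by positivity
  have c4 : 0 ≤ s * (1 / 8 - e) := mul_nonneg hs0 (by linarith)
  have c5 : 0 ≤ s * e ^ 2 := by positivity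
  have c6 : 0 ≤ e ^ 3 := by positivity
  have c8 : 0 ≤ s ^ 2 * e := by positivity
  have c7 : 0 ≤ s ^ 3 := by positivity
  linarith

end Moments

/-! ### Avoiding a five-wise independent family of subspaces -/

section Sieve

variable {F V : Type*} [Field F] [AddCommGroup V] [Module F V] [Module.Finite F V]
variable [Finite F] [Finite V]

open Classical in
/-- The binomial moments, up to the fifth, of the number of members of `𝒰` on which a form is
symmetric, when any five members are independent. -/
theorem sum_choose_card_filter [Fintype (LinearMap.BilinForm F V)]
    {𝒰 : Finset (Submodule F V)}
    (hind : ∀ T ⊆ 𝒰, T.card ≤ 5 → FrameIndep T) {k : ℕ} (hk : k ≤ 5) :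
    (∑ f : LinearMap.BilinForm F V, (𝒰.filter (f ∈ symmOn ·)).card.choose k) *
      (Nat.card F ^ 3) ^ k = 𝒰.card.choose k * Nat.card (LinearMap.BilinForm F V) := by
  -- The binomial coefficient counts the k-subsets of `𝒰` on all of whose members f is symmetric;
  -- exchanging the sums then leaves one count for each subset.
  have h1 : ∀ f : LinearMap.BilinForm F V, (𝒰.filter (f ∈ symmOn ·)).card.choose k =
      ∑ T ∈ 𝒰.powersetCard k, if f ∈ symmOnAll T then 1 else 0 := by
    intro f
    rw [← Finset.card_powersetCard, ← Finset.card_filter]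
    congr 1
    ext T
    simp only [Finset.mem_powersetCard, Finset.mem_filter, Finset.subset_iff, mem_symmOnAll]
    constructor
    · rintro ⟨h, hc⟩
      exact ⟨⟨fun U hU => (h hU).1, hc⟩, fun U hU => (h hU).2⟩
    · rintro ⟨⟨h, hc⟩, h'⟩
      exact ⟨fun U hU => ⟨h hU, h' U hU⟩, hc⟩
  simp_rw [h1]
  rw [Finset.sum_comm, Finset.sum_mul, ← Finset.card_powersetCard, ← smul_eq_mul (Finset.card _),
    ← Finset.sum_const]
  refine Finset.sum_congr rfl fun T hT => ?_
  rw [Finset.mem_powersetCard] at hT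
  rw [← card_symmOnAll (hind T hT.1 (by omega)), hT.2, ← Finset.card_filter]
  congr 1
  rw [Nat.card_eq_fintype_card, Fintype.card_subtype]

/-- If any five members of `𝒰` are independent and `𝒰` is not too large, a positive proportion of
the forms is symmetric on no member of `𝒰`. -/
theorem card_le_mul_ncard_forall_notMem_symmOn {𝒰 : Finset (Submodule F V)}
    (hind : ∀ T ⊆ 𝒰, T.card ≤ 5 → FrameIndep T) (hX : 20 * 𝒰.card ≤ 61 * Nat.card F ^ 3) :
    Nat.card (LinearMap.BilinForm F V) ≤
      672 * {f : LinearMap.BilinForm F V | ∀ U ∈ 𝒰, f ∉ symmOn U}.ncard := by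
  classical
  have := finite_bilinForm (F := F) (V := V)
  have := Fintype.ofFinite (LinearMap.BilinForm F V)
  set M := Nat.card (LinearMap.BilinForm F V) with hM
  set Q : ℝ := (Nat.card F : ℝ) ^ 3 with hQ
  have hF2 : (2 : ℝ) ≤ Nat.card F := by exact_mod_cast Finite.one_lt_card (α := F)
  have hQ8 : 8 ≤ Q := by
    have := pow_le_pow_left₀ (by norm_num) hF2 3
    norm_num at this
    exact this
  have hQ0 : 0 < Q := by linarith
  let Y : LinearMap.BilinForm F V → ℕ := fun f => (𝒰.filter (f ∈ symmOn ·)).card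
  have hmom : ∀ k : Fin 6, ∑ f, ((Y f).choose k : ℝ) = 𝒰.card.choose k * M / Q ^ (k : ℕ) := by
    intro k
    rw [eq_div_iff (by positivity)]
    have := sum_choose_card_filter hind (k := k) (by omega)
    rw [hQ]
    exact_mod_cast this
  have hcount : (∑ f, if Y f = 0 then (1 : ℝ) else 0) =
      {f : LinearMap.BilinForm F V | ∀ U ∈ 𝒰, f ∉ symmOn U}.ncard := by
    rw [Finset.sum_boole, Set.ncard_eq_toFinset_card']
    congr 2
    ext f
    simp [Y, Finset.filter_eq_empty_iff]
  have hupper : ∑ f, ∑ k : Fin 6, sieveCoeff k * ((Y f).choose k : ℝ) ≤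
      {f : LinearMap.BilinForm F V | ∀ U ∈ 𝒰, f ∉ symmOn U}.ncard := by
    rw [← hcount]
    exact Finset.sum_le_sum fun f _ => sum_sieveCoeff_choose_le (Y f)
  have hlower : (M : ℝ) / 672 ≤ ∑ f, ∑ k : Fin 6, sieveCoeff k * ((Y f).choose k : ℝ) := by
    rw [Finset.sum_comm]
    simp_rw [← Finset.mul_sum, hmom]
    obtain ⟨e0, e1, e2, e3, e4, e5⟩ := cast_choose_eqs 𝒰.card
    have hpoly := sieve_polynomial_ge (x := 𝒰.card / Q) (e := 1 / Q) (by positivity)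
      (by rw [div_le_iff₀ hQ0]
          have : (20 : ℝ) * 𝒰.card ≤ 61 * Q := by rw [hQ]; exact_mod_cast hX
          linarith) (by positivity) (by rw [div_le_div_iff₀ hQ0 (by norm_num)]; linarith)
    have := mul_le_mul_of_nonneg_left hpoly (Nat.cast_nonneg (α := ℝ) M)
    refine le_trans (by rw [mul_one_div]) (this.trans (le_of_eq ?_))
    simp only [Fin.sum_univ_six, sieveCoeff]
    simp only [Fin.isValue, Matrix.cons_val, Fin.val_zero, Fin.val_one, Fin.val_two,
      show ((3 : Fin 6) : ℕ) = 3 from rfl, show ((4 : Fin 6) : ℕ) = 4 from rfl,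
      show ((5 : Fin 6) : ℕ) = 5 from rfl, e0, e1, e2, e3, e4, e5]
    field_simp
    ring
  have := hlower.trans hupper
  rw [div_le_iff₀ (by norm_num)] at this
  have h2 : (M : ℝ) ≤ 672 * ({f : LinearMap.BilinForm F V | ∀ U ∈ 𝒰, f ∉ symmOn U}.ncard : ℝ) := by
    linarith
  exact_mod_cast h2

end Sieve

/-! ### Union bound and counting of tuples -/

section UnionBound

theorem ncard_mul_le_of_subset_iUnion {Ω I : Type*} [Finite Ω] [Finite I] {A : Set Ω}
    {B : I → Set Ω} (hA : A ⊆ ⋃ i, B i) {K N : ℕ} (hB : ∀ i, (B i).ncard * K ≤ N) :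
    A.ncard * K ≤ Nat.card I * N := by
  have := Fintype.ofFinite I
  have h1 : A.ncard ≤ ∑ i, (B i).ncard := by
    refine (Set.ncard_le_ncard hA (Set.toFinite _)).trans ?_
    have := Set.ncard_iUnion_le_of_fintype B
    simpa using this
  calc A.ncard * K ≤ (∑ i, (B i).ncard) * K := Nat.mul_le_mul_right _ h1
    _ = ∑ i, (B i).ncard * K := Finset.sum_mul ..
    _ ≤ ∑ _i : I, N := Finset.sum_le_sum fun i _ => hB i
    _ = Nat.card I * N := by simp

theorem ncard_forall_mem {ι M : Type*} [Fintype ι] (Z : Set M) :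
    {b : ι → M | ∀ i, b i ∈ Z}.ncard = Z.ncard ^ Fintype.card ι := by
  rw [← Nat.card_coe_set_eq, ← Nat.card_coe_set_eq, ← Nat.card_eq_fintype_card, ← Nat.card_fun]
  exact Nat.card_congr (Equiv.subtypePiEquivPi (p := fun _ x => x ∈ Z))

end UnionBound

/-! ### Common isotropic three-spaces of n - 4 forms -/

section Isotropic

variable {F V : Type*} [Field F] [AddCommGroup V] [Module F V] [Module.Finite F V]
variable [Finite F] [Finite V]

/-- The three-dimensional subspaces on which all the forms `b i` are symmetric. -/
noncomputable def isotropicThree {ι : Type*} (b : ι → LinearMap.BilinForm F V) :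
    Finset (Submodule F V) :=
  (Set.toFinite {U : Submodule F V | finrank F U = 3 ∧ ∀ i, b i ∈ symmOn U}).toFinset

omit [Module.Finite F V] [Finite F] in
theorem mem_isotropicThree {ι : Type*} {b : ι → LinearMap.BilinForm F V} {U : Submodule F V} :
    U ∈ isotropicThree b ↔ finrank F U = 3 ∧ ∀ i, b i ∈ symmOn U := by
  simp [isotropicThree]

omit [Finite F] [Finite V] in
theorem frameIndep_empty : FrameIndep (∅ : Finset (Submodule F V)) :=
  linearIndependent_empty_type

omit [Finite F] [Finite V] in
theorem frameSpan_empty : frameSpan (∅ : Finset (Submodule F V)) = ⊥ := by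
  simp [frameSpan]

theorem card_symmOn {U : Submodule F V} (hU : finrank F U = 3) :
    Nat.card (symmOn U) * Nat.card F ^ 3 = Nat.card (LinearMap.BilinForm F V) := by
  classical
  have h : FrameIndep (insert U (∅ : Finset (Submodule F V))) :=
    frameIndep_empty.insert hU (by simp [frameSpan_empty])
  have := card_symmOnAll h
  simpa [symmOnAll] using this

omit [Finite V] in
-- The proportion of bases among triples is (1 - q^(-3))(1 - q^(-2))(1 - q^(-1)), which is smallest
-- at q = 2, with value 21/64.
theorem le_card_linearIndependent_three {U : Type*} [AddCommGroup U] [Module F U] [Finite U]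
    (hU : finrank F U = 3) :
    21 * Nat.card F ^ 9 ≤ 64 * Nat.card {s : Fin 3 → U // LinearIndependent F s} := by
  have := Fintype.ofFinite F
  rw [card_linearIndependent (by rw [hU]), hU, Nat.card_eq_fintype_card]
  have hq : 2 ≤ Fintype.card F := by
    rw [← Nat.card_eq_fintype_card]; exact Finite.one_lt_card
  generalize Fintype.card F = q at hq
  simp only [Fin.prod_univ_three, Fin.val_zero, Fin.val_one, Fin.val_two, pow_zero, pow_one]
  have h1 : 1 ≤ q ^ 3 := Nat.one_le_pow _ _ (by omega)
  have h2 : q ≤ q ^ 3 := Nat.le_self_pow (by norm_num) q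
  have h3 : q ^ 2 ≤ q ^ 3 := Nat.pow_le_pow_right (by omega) (by norm_num)
  have a1 : 7 * q ^ 3 ≤ 8 * (q ^ 3 - 1) := by
    have : 2 ^ 3 ≤ q ^ 3 := Nat.pow_le_pow_left hq 3
    omega
  have a2 : 3 * q ^ 3 ≤ 4 * (q ^ 3 - q) := by
    have : 4 * q ≤ q ^ 3 := by nlinarith
    omega
  have a3 : q ^ 3 ≤ 2 * (q ^ 3 - q ^ 2) := by
    have : 2 * q ^ 2 ≤ q ^ 3 := by nlinarith [sq_nonneg q]
    omega
  calc 21 * q ^ 9 = (7 * q ^ 3) * (3 * q ^ 3) * q ^ 3 := by ring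
    _ ≤ (8 * (q ^ 3 - 1)) * (4 * (q ^ 3 - q)) * (2 * (q ^ 3 - q ^ 2)) := by gcongr
    _ = _ := by ring

/-- The number of three-dimensional subspaces. -/
theorem card_finrank_three_le :
    21 * Nat.card F ^ 9 * Nat.card {U : Submodule F V // finrank F U = 3} ≤
      64 * Nat.card F ^ (3 * finrank F V) := by
  have hcard : Nat.card ((U : {U : Submodule F V // finrank F U = 3}) ×
      {s : Fin 3 → U.1 // LinearIndependent F s}) ≤ Nat.card (Fin 3 → V) := by
    refine Nat.card_le_card_of_injective (fun a i => (a.2.1 i : V)) ?_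
    -- A basis recovers its subspace as its span, so pairs (subspace, basis) embed into triples of
    -- vectors.
    have hspan : ∀ a : (U : {U : Submodule F V // finrank F U = 3}) ×
      {s : Fin 3 → U.1 // LinearIndependent F s},
      Submodule.span F (Set.range fun i => (a.2.1 i : V)) = a.1.1 := by
      rintro ⟨⟨U, hU⟩, s, hs⟩
      have := hs.span_eq_top_of_card_eq_finrank (by simp [hU])
      rw [show (fun i => (s i : V)) = U.subtype ∘ s from rfl, Set.range_comp,
        ← Submodule.map_span, this, Submodule.map_top, Submodule.range_subtype]
    rintro ⟨⟨U, hU⟩, s, hs⟩ ⟨⟨W, hW⟩, t, ht⟩ h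
    have h1 := hspan ⟨⟨U, hU⟩, s, hs⟩
    have h2 := hspan ⟨⟨W, hW⟩, t, ht⟩
    simp only at h h1 h2
    have : U = W := by rw [← h1, ← h2, h]
    subst this
    have : s = t := by
      ext i; exact congrFun h i
    subst this
    rfl
  have := Fintype.ofFinite {U : Submodule F V // finrank F U = 3}
  rw [Nat.card_sigma, Nat.card_fun, Module.natCard_eq_pow_finrank (K := F), ← pow_mul,
    Nat.card_fin, mul_comm (finrank F V)] at hcard
  calc 21 * Nat.card F ^ 9 * Nat.card {U : Submodule F V // finrank F U = 3}
      = ∑ _U : {U : Submodule F V // finrank F U = 3}, 21 * Nat.card F ^ 9 := by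
        simp [mul_comm]
    _ ≤ ∑ U : {U : Submodule F V // finrank F U = 3},
        64 * Nat.card {s : Fin 3 → U.1 // LinearIndependent F s} :=
        Finset.sum_le_sum fun U _ => le_card_linearIndependent_three U.2
    _ ≤ _ := by rw [← Finset.mul_sum]; exact Nat.mul_le_mul_left _ hcard

/-- Few tuples of forms have many common isotropic three-dimensional subspaces. -/
theorem ncard_large_isotropicThree_le {w : ℕ} (hw : w + 4 = finrank F V) :
    {b : Fin w → LinearMap.BilinForm F V |
        61 * Nat.card F ^ 3 < 20 * (isotropicThree b).card}.ncard * 1281 ≤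
      1280 * Nat.card (LinearMap.BilinForm F V) ^ w := by
  classical
  have := finite_bilinForm (F := F) (V := V)
  have := Fintype.ofFinite (LinearMap.BilinForm F V)
  have := Fintype.ofFinite (Submodule F V)
  set M := Nat.card (LinearMap.BilinForm F V) with hM
  set q := Nat.card F with hq
  have hq0 : 0 < q := Nat.card_pos
  set A := {b : Fin w → LinearMap.BilinForm F V | 61 * q ^ 3 < 20 * (isotropicThree b).card} with hA
  have hsum : (∑ b : Fin w → LinearMap.BilinForm F V, (isotropicThree b).card) * q ^ (3 * w) =
      Nat.card {U : Submodule F V // finrank F U = 3} * M ^ w := by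
    have h1 : ∀ b : Fin w → LinearMap.BilinForm F V, (isotropicThree b).card =
        ∑ U ∈ Finset.univ.filter (fun U : Submodule F V => finrank F U = 3), if ∀ i, b i ∈ symmOn U then 1 else 0 := by
      intro b
      rw [← Finset.card_filter, Finset.filter_filter]
      congr 1
      ext U
      simp [mem_isotropicThree]
    simp_rw [h1]
    rw [Finset.sum_comm, Finset.sum_mul, Nat.card_eq_fintype_card, Fintype.card_subtype,
      ← smul_eq_mul (Finset.card _), ← Finset.sum_const]
    refine Finset.sum_congr rfl fun U hU => ?_
    have hU3 : finrank F U = 3 := (Finset.mem_filter.1 hU).2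
    rw [← Finset.card_filter, hM, ← card_symmOn hU3, mul_pow, ← pow_mul]
    congr 1
    have := ncard_forall_mem (ι := Fin w) (symmOn U : Set (LinearMap.BilinForm F V))
    rw [Set.ncard_eq_toFinset_card', Fintype.card_fin] at this
    rw [← Nat.card_coe_set_eq] at this
    refine Eq.trans ?_ this
    congr 1
    ext b
    simp
  have hmarkov : A.ncard * (61 * q ^ 3) ≤
      20 * ∑ b : Fin w → LinearMap.BilinForm F V, (isotropicThree b).card := by
    rw [Set.ncard_eq_toFinset_card', ← smul_eq_mul, ← Finset.sum_const, Finset.mul_sum]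
    refine (Finset.sum_le_sum fun b hb => ?_).trans
      (Finset.sum_le_sum_of_subset (Finset.subset_univ A.toFinset))
    rw [Set.mem_toFinset] at hb
    exact hb.le
  have hcount := card_finrank_three_le (F := F) (V := V)
  rw [← hq, ← hw] at hcount
  have hpos : 0 < q ^ (3 * w + 12) := by positivity
  -- The mean is at most (64/21) q^3 and the Markov threshold is (61/20) q^3; their ratio is
  -- 1280/1281, just below 1.
  refine Nat.le_of_mul_le_mul_right ?_ hpos
  calc A.ncard * 1281 * q ^ (3 * w + 12)
      = A.ncard * (61 * q ^ 3) * (21 * q ^ 9 * q ^ (3 * w)) := by ring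
    _ ≤ (20 * ∑ b : Fin w → LinearMap.BilinForm F V, (isotropicThree b).card) *
        (21 * q ^ 9 * q ^ (3 * w)) := Nat.mul_le_mul_right _ hmarkov
    _ = 20 * (21 * q ^ 9) *
        ((∑ b : Fin w → LinearMap.BilinForm F V, (isotropicThree b).card) * q ^ (3 * w)) := by ring
    _ = 20 * M ^ w * (21 * q ^ 9 * Nat.card {U : Submodule F V // finrank F U = 3}) := by
        rw [hsum]; ring
    _ ≤ 20 * M ^ w * (64 * q ^ (3 * (w + 4))) := Nat.mul_le_mul_left _ hcount
    _ = 1280 * M ^ w * q ^ (3 * w + 12) := by ring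

/-- The tuples of forms with a common isotropic three-dimensional subspace meeting the span of
independent other ones, at most four in number. -/
def dependentTuples (F V : Type*) [Field F] [AddCommGroup V] [Module F V] [Module.Finite F V]
    [Finite V] (w : ℕ) : Set (Fin w → LinearMap.BilinForm F V) :=
  {b | ∃ T ⊆ isotropicThree b, T.card ≤ 4 ∧ FrameIndep T ∧
    ∃ U ∈ isotropicThree b, U ∉ T ∧ finrank F (U ⊓ frameSpan T : Submodule F V) ≠ 0}

omit [Finite F] in
-- Independence is built up one subspace at a time: outside the exceptional set, each new member is
-- disjoint from the span of at most four earlier ones.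
theorem frameIndep_of_notMem_dependentTuples {w : ℕ} {b : Fin w → LinearMap.BilinForm F V}
    (hb : b ∉ dependentTuples F V w) (T : Finset (Submodule F V)) (hT : T ⊆ isotropicThree b)
    (hT5 : T.card ≤ 5) : FrameIndep T := by
  classical
  induction T using Finset.induction_on with
  | empty => exact frameIndep_empty
  | insert U T hU ih =>
    rw [Finset.card_insert_of_notMem hU] at hT5
    have hTi := ih ((Finset.subset_insert _ _).trans hT) (by omega)
    have hUb := hT (Finset.mem_insert_self _ _)
    refine hTi.insert (mem_isotropicThree.1 hUb).1 ?_
    by_contra h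
    exact hb ⟨T, (Finset.subset_insert _ _).trans hT, by omega, hTi, U, hUb, hU, h⟩

theorem ncard_dependentTuples_le {w : ℕ} (hw : w + 4 = finrank F V) (hw156 : 156 ≤ w) :
    (dependentTuples F V w).ncard * Nat.card F ^ 72 ≤
      15 * Nat.card (LinearMap.BilinForm F V) ^ w := by
  classical
  have := finite_bilinForm (F := F) (V := V)
  set M := Nat.card (LinearMap.BilinForm F V) with hM
  set q := Nat.card F with hq
  have hq0 : 0 < q := Nat.card_pos
  have hV : Nat.card V = q ^ (w + 4) := by
    rw [hw]; exact Module.natCard_eq_pow_finrank (K := F)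
  -- The 15 cases are |T| ≤ 4 and intersection dimension 1, 2, 3; the second index is shifted by
  -- one.
  let B : Fin 5 × Fin 3 → Set (Fin w → LinearMap.BilinForm F V) := fun a =>
    {b | ∃ T : Finset (Submodule F V), T.card = a.1 ∧ FrameIndep T ∧ ∃ U : Submodule F V,
      finrank F U = 3 ∧ finrank F (U ⊓ frameSpan T : Submodule F V) = a.2 + 1 ∧ U ∉ T ∧
      ∀ i, b i ∈ symmOnAll T ⊓ symmOn U}
  have hcov : dependentTuples F V w ⊆ ⋃ a, B a := by
    rintro b ⟨T, hT, hT4, hTi, U, hU, hUT, hd⟩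
    obtain ⟨hU3, hUb⟩ := mem_isotropicThree.1 hU
    have hle : finrank F (U ⊓ frameSpan T : Submodule F V) ≤ 3 := by
      rw [← hU3]; exact Submodule.finrank_mono inf_le_left
    rw [Set.mem_iUnion]
    refine ⟨(⟨T.card, by omega⟩, ⟨finrank F (U ⊓ frameSpan T : Submodule F V) - 1, by omega⟩),
      T, rfl, hTi, U, hU3, by simp only; omega, hUT, fun i => ⟨?_, hUb i⟩⟩
    exact mem_symmOnAll.2 fun W hW => (mem_isotropicThree.1 (hT hW)).2 i
  have hB : ∀ a, (B a).ncard * q ^ 72 ≤ M ^ w := by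
    rintro ⟨τ, d⟩
    obtain ⟨τ, hτ⟩ := τ
    obtain ⟨d, hd⟩ := d
    let I := (T : {T : Finset (Submodule F V) // T.card = τ ∧ FrameIndep T}) ×
      {U : Submodule F V // finrank F U = 3 ∧
        finrank F (U ⊓ frameSpan T.1 : Submodule F V) = d + 1}
    let C : I → Set (Fin w → LinearMap.BilinForm F V) := fun a =>
      {b | a.2.1 ∉ a.1.1 ∧ ∀ i, b i ∈ symmOnAll a.1.1 ⊓ symmOn a.2.1}
    have hBC : B (⟨τ, hτ⟩, ⟨d, hd⟩) ⊆ ⋃ a, C a := by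
      rintro b ⟨T, hTc, hTi, U, hU3, hUd, hUT, hb⟩
      exact Set.mem_iUnion.2 ⟨⟨⟨T, hTc, hTi⟩, ⟨U, hU3, hUd⟩⟩, hUT, hb⟩
    have hC : ∀ a, (C a).ncard * q ^ ((3 * τ + (3 - d)) * w) ≤ M ^ w := by
      rintro ⟨⟨T, hTc, hTi⟩, ⟨U, hU3, hUd⟩⟩
      by_cases hUT : U ∈ T
      · simp [C, hUT]
      · have h1 : (C ⟨⟨T, hTc, hTi⟩, ⟨U, hU3, hUd⟩⟩).ncard =
            Nat.card (symmOnAll T ⊓ symmOn U : Submodule F (LinearMap.BilinForm F V)) ^ w := by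
          have := ncard_forall_mem (ι := Fin w)
            ((symmOnAll T ⊓ symmOn U : Submodule F (LinearMap.BilinForm F V)) :
              Set (LinearMap.BilinForm F V))
          rw [Fintype.card_fin, ← Nat.card_coe_set_eq (SetLike.coe _)] at this
          rw [SetLike.coe_sort_coe] at this
          rw [← this]
          simp [C, hUT]
        have h2 := card_symmOnAll_inf hTi hU3 hUT (Nat.succ_ne_zero d) hUd
        have h3 := card_symmOnAll hTi
        rw [hTc] at h3
        rw [h1, pow_mul, ← mul_pow]
        refine Nat.pow_le_pow_left ?_ w
        rw [hM, ← h3, ← hq, pow_add, mul_comm (q ^ (3 * τ)), ← mul_assoc, pow_mul]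
        exact Nat.mul_le_mul_right _ (by simpa using h2)
    have hI : Nat.card I ≤ q ^ (3 * (w + 4) * τ + (3 * τ * (d + 1) + (w + 4) * (2 - d))) := by
      have := Fintype.ofFinite {T : Finset (Submodule F V) // T.card = τ ∧ FrameIndep T}
      have hT : Nat.card {T : Finset (Submodule F V) // T.card = τ ∧ FrameIndep T} ≤
          q ^ (3 * (w + 4) * τ) := by
        have : Nat.card {T : Finset (Submodule F V) // T.card = τ ∧ FrameIndep T} ≤
            Nat.card (Fin τ → Fin 3 → V) := by
          have henum : ∀ T : {T : Finset (Submodule F V) // T.card = τ ∧ FrameIndep T},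
              ∃ g : Fin τ → Fin 3 → V,
                Set.range (fun j => Submodule.span F (Set.range (g j))) = (T.1 : Set _) := by
            rintro ⟨T, hTc, hTi⟩
            let en := (T.equivFinOfCardEq hTc).symm
            refine ⟨fun j => frame (en j).1, ?_⟩
            ext U
            simp only [Set.mem_range, Finset.mem_coe]
            constructor
            · rintro ⟨j, rfl⟩
              rw [span_frame (hTi.finrank_eq (en j).2)]
              exact (en j).2
            · intro hU
              exact ⟨en.symm ⟨U, hU⟩, by simp [span_frame (hTi.finrank_eq hU)]⟩
          choose g hg using henum
          refine Nat.card_le_card_of_injective g fun T T' h => Subtype.ext ?_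
          rw [← Finset.coe_inj, ← hg, ← hg, h]
        refine this.trans (le_of_eq ?_)
        rw [Nat.card_fun, Nat.card_fun, hV, Nat.card_fin, Nat.card_fin]
        ring
      rw [Nat.card_sigma]
      refine (Finset.sum_le_sum (g := fun _ => q ^ (3 * τ * (d + 1) + (w + 4) * (2 - d)))
        fun T _ => ?_).trans ?_
      · refine (card_finrank_inf_eq_le (frameSpan T.1) (by omega)).trans ?_
        rw [pow_add q, hV, ← pow_mul, show 3 - (d + 1) = 2 - d by omega]
        refine Nat.mul_le_mul_right _ ?_
        rw [pow_mul]
        refine Nat.pow_le_pow_left ?_ _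
        have := card_frameSpan_le T.1
        rwa [T.2.1] at this
      · rw [Finset.sum_const, smul_eq_mul, pow_add q (3 * (w + 4) * τ), Finset.card_univ, ← Nat.card_eq_fintype_card]
        exact Nat.mul_le_mul_right _ hT
    have h := ncard_mul_le_of_subset_iUnion hBC hC
    have h' := h.trans (Nat.mul_le_mul_right _ hI)
    -- The gain of conditions over choices is w - (12τ + 3τ(d+1) + 4(2-d)). The worst case τ = 4, d
    -- = 2 gives w - 84, which is at least 72 because w ≥ 156; the numbers 156 and 72 match here.
    have hexp : 3 * (w + 4) * τ + (3 * τ * (d + 1) + (w + 4) * (2 - d)) + 72 ≤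
        (3 * τ + (3 - d)) * w := by
      interval_cases d <;> interval_cases τ <;> omega
    refine Nat.le_of_mul_le_mul_right (c := q ^
      (3 * (w + 4) * τ + (3 * τ * (d + 1) + (w + 4) * (2 - d)))) ?_ (by positivity)
    rw [mul_comm (M ^ w)]
    refine le_trans ?_ h'
    rw [mul_assoc, ← pow_add]
    exact Nat.mul_le_mul_left _ (Nat.pow_le_pow_right hq0 (by omega))
  have := ncard_mul_le_of_subset_iUnion hcov hB
  simpa using this

end Isotropic

/-! ### Union bound for subspaces of dimension at least four -/

section FirstMoment

variable {F V : Type*} [Field F] [AddCommGroup V] [Module F V]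

/-- The span of the values on `U` of the alternating map with components `b i x y - b i y x`. -/
def skewSpan {m : ℕ} (b : Fin m → LinearMap.BilinForm F V) (U : Submodule F V) :
    Submodule F (Fin m → F) :=
  Submodule.span F {v | ∃ x ∈ U, ∃ y ∈ U, v = fun i => b i x y - b i y x}

variable [Module.Finite F V]

/-- Taking values in a subspace of codimension `k` on a subspace of dimension `u` amounts to
`k * u.choose 2` independent conditions. -/
theorem ncard_skewSpan_le_mul [Finite F] [Finite V] {m u k C : ℕ} {U : Submodule F V}
    (hU : finrank F U = u) {L : Submodule F (Fin m → F)} (hL : finrank F L + k = m)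
    (hC : 2 * C = u * (u - 1)) :
    {b : Fin m → LinearMap.BilinForm F V | skewSpan b U ≤ L}.ncard * Nat.card F ^ (k * C) ≤
      Nat.card (LinearMap.BilinForm F V) ^ m := by
  classical
  have := finite_bilinForm (F := F) (V := V)
  let z : Fin u → V := fun i => finBasisOfFinrankEq F U hU i
  have hz : LinearIndependent F z :=
    (finBasisOfFinrankEq F U hU).linearIndependent.map' U.subtype (by simp)
  -- Pairs i < j of basis indices: the skew values on them can be prescribed freely modulo `L`.
  let P := (j : Fin u) × Fin j.1
  let snd : P → Fin u := fun a => ⟨a.2.1, a.2.2.trans a.1.2⟩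
  let φ : (Fin m → LinearMap.BilinForm F V) →ₗ[F] (P → (Fin m → F) ⧸ L) :=
    LinearMap.pi fun a => L.mkQ ∘ₗ LinearMap.pi fun t =>
      skewAt (z a.1) (z (snd a)) ∘ₗ LinearMap.proj t
  have hsurj : Function.Surjective φ := by
    intro c
    choose c' hc' using fun a => L.mkQ_surjective (c a)
    choose b hb using fun t : Fin m => hz.exists_bilinForm (fun j i =>
      if h : i.1 < j.1 then c' ⟨j, ⟨i.1, h⟩⟩ t else 0)
    refine ⟨b, ?_⟩
    ext a
    rw [← hc' a]
    simp only [φ, LinearMap.pi_apply, LinearMap.comp_apply]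
    congr 1
    ext t
    obtain ⟨j, i⟩ := a
    have h1 : ¬ (j.1 < i.1) := by have := i.2; omega
    simp [hb, snd, h1]
  have hker : {b : Fin m → LinearMap.BilinForm F V | skewSpan b U ≤ L} ⊆
      (LinearMap.ker φ : Set (Fin m → LinearMap.BilinForm F V)) := by
    intro b hb
    rw [SetLike.mem_coe, LinearMap.mem_ker]
    ext a
    refine (Submodule.Quotient.mk_eq_zero L).2 (hb (Submodule.subset_span ?_))
    exact ⟨z a.1, (finBasisOfFinrankEq F U hU a.1).2, z (snd a),
      (finBasisOfFinrankEq F U hU (snd a)).2, rfl⟩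
  have hle := Set.ncard_le_ncard hker (Set.toFinite _)
  rw [← Nat.card_coe_set_eq (LinearMap.ker φ : Set (Fin m → LinearMap.BilinForm F V))] at hle
  have hcard := card_ker_mul_card (F := F) (M := Fin m → LinearMap.BilinForm F V) φ hsurj
  have hPc : Fintype.card P = C := by
    have : Fintype.card P = ∑ j ∈ Finset.range u, j := by
      rw [Fintype.card_sigma, ← Fin.sum_univ_eq_sum_range]
      simp
    have h2 := Finset.sum_range_id_mul_two u
    omega
  have hq : Nat.card ((Fin m → F) ⧸ L) = Nat.card F ^ k := by
    rw [Module.natCard_eq_pow_finrank (K := F)]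
    congr 1
    have := L.finrank_quotient_add_finrank
    rw [finrank_fin_fun] at this
    omega
  rw [Nat.card_fun, Nat.card_fun, Nat.card_fin, hq, Nat.card_eq_fintype_card (α := P), hPc,
    ← pow_mul] at hcard
  rw [← hcard]
  exact Nat.mul_le_mul_right _ hle

omit [Module.Finite F V] in
theorem card_finrank_eq_le_pow [FiniteDimensional F V] [Finite V] (u : ℕ) :
    Nat.card {U : Submodule F V // finrank F U = u} ≤ Nat.card V ^ u := by
  have h : ∀ U : {U : Submodule F V // finrank F U = u},
      ∃ z : Fin u → V, Submodule.span F (Set.range z) = U.1 := by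
    rintro ⟨U, hU⟩
    refine ⟨U.subtype ∘ finBasisOfFinrankEq F U hU, ?_⟩
    rw [Set.range_comp, ← Submodule.map_span, Basis.span_eq, Submodule.map_top,
      Submodule.range_subtype]
  choose g hg using h
  have := Nat.card_le_card_of_injective g fun A B hAB => Subtype.ext (by rw [← hg A, ← hg B, hAB])
  simpa [Nat.card_fun] using this

/-- Subspaces of dimension `u` are spanned by `u` vectors. -/
theorem card_finrank_eq_le [Finite F] [Finite V] (u : ℕ) :
    Nat.card {U : Submodule F V // finrank F U = u} ≤ Nat.card F ^ (finrank F V * u) := by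
  rw [pow_mul, ← Module.natCard_eq_pow_finrank (K := F) (V := V)]
  exact card_finrank_eq_le_pow u

/-- Subspaces of codimension `k` are cut out by `k` functionals. -/
theorem card_finrank_eq_le_of_codim [Finite F] {u k : ℕ} (huk : u + k = finrank F V) :
    Nat.card {U : Submodule F V // finrank F U = u} ≤ Nat.card F ^ (finrank F V * k) := by
  have : Finite (Dual F V) := Module.finite_of_finite F
  have hinj : Nat.card {U : Submodule F V // finrank F U = u} ≤
      Nat.card {W : Submodule F (Dual F V) // finrank F W = k} := by
    refine Nat.card_le_card_of_injective
      (fun U => ⟨U.1.dualAnnihilator, ?_⟩) fun A B h => ?_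
    · have := Subspace.finrank_add_finrank_dualAnnihilator_eq U.1
      rw [U.2] at this
      omega
    · exact Subtype.ext (Subspace.dualAnnihilator_inj.1 (congrArg Subtype.val h))
  have := card_finrank_eq_le (F := F) (V := Dual F V) k
  rw [Subspace.dual_finrank_eq] at this
  exact hinj.trans this

/-- A subspace of dimension at most `l` is contained in one of dimension `l`. -/
theorem Submodule.exists_ge_finrank_eq (L : Submodule F V) {l : ℕ} (h1 : finrank F L ≤ l)
    (h2 : l ≤ finrank F V) : ∃ L', L ≤ L' ∧ finrank F L' = l := by
  induction l, h1 using Nat.le_induction with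
  | base => exact ⟨L, le_rfl, rfl⟩
  | succ l hl ih =>
    obtain ⟨L', hL', hl'⟩ := ih (by omega)
    have hne : L' ≠ ⊤ := by
      rintro rfl
      rw [finrank_top] at hl'
      omega
    obtain ⟨x, hx⟩ := SetLike.exists_not_mem_of_ne_top L' hne
    refine ⟨L' ⊔ Submodule.span F {x}, hL'.trans le_sup_left, ?_⟩
    have hx0 : x ≠ 0 := fun h => hx (h ▸ L'.zero_mem)
    have h3 := Submodule.finrank_sup_add_finrank_inf_eq L' (Submodule.span F {x})
    rw [disjoint_iff.1 ((Submodule.disjoint_span_singleton' hx0).2 hx), finrank_bot,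
      finrank_span_singleton hx0, hl'] at h3
    omega

/-- The tuples of forms whose alternating map has too few values on some proper subspace of
dimension at least four. -/
def deficientTuples (F V : Type*) [Field F] [AddCommGroup V] [Module F V] (m : ℕ) :
    Set (Fin m → LinearMap.BilinForm F V) :=
  {b | ∃ U : Submodule F V, 4 ≤ finrank F U ∧ finrank F U < finrank F V ∧
    finrank F (skewSpan b U) + 3 ≤ finrank F U}

/-- A deficient U of dimension u has its values in some L of dimension u - 3, hence of codimension n
- u, at the cost of (n - u)·u(u-1)/2 conditions. The tightest case is u = 4, where 6(n-4) - 4n -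
(n-3) = n - 21. -/
theorem ncard_deficientTuples_le [Finite F] [Finite V] {m n : ℕ} (hn : finrank F V = n)
    (hm : m + 3 = n) (hn160 : 160 ≤ n) :
    (deficientTuples F V m).ncard * Nat.card F ^ (n - 21) ≤
      n * Nat.card (LinearMap.BilinForm F V) ^ m := by
  classical
  have := finite_bilinForm (F := F) (V := V)
  set M := Nat.card (LinearMap.BilinForm F V) with hM
  set q := Nat.card F with hq
  have hq0 : 0 < q := Nat.card_pos
  let B : Fin n → Set (Fin m → LinearMap.BilinForm F V) := fun u =>
    {b | 4 ≤ u.1 ∧ ∃ U : Submodule F V, finrank F U = u ∧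
      ∃ L : Submodule F (Fin m → F), finrank F L = u - 3 ∧ skewSpan b U ≤ L}
  have hcov : deficientTuples F V m ⊆ ⋃ u, B u := by
    rintro b ⟨U, hU4, hUn, hb⟩
    rw [Set.mem_iUnion]
    obtain ⟨L, hL, hLc⟩ := (skewSpan b U).exists_ge_finrank_eq (l := finrank F U - 3) (by omega)
      (by rw [finrank_fin_fun]; omega)
    exact ⟨⟨finrank F U, by omega⟩, hU4, U, rfl, L, hLc, hL⟩
  have hB : ∀ u, (B u).ncard * q ^ (n - 21) ≤ M ^ m := by
    rintro ⟨u, hun⟩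
    by_cases hu4 : 4 ≤ u
    swap
    · simp [B, hu4]
    obtain ⟨k, hk⟩ : ∃ k, u + k = n := ⟨n - u, by omega⟩
    obtain ⟨C, hC⟩ : ∃ C, 2 * C = u * (u - 1) := by
      obtain ⟨C, hC⟩ := (Nat.even_mul_pred_self u)
      exact ⟨C, by omega⟩
    let I := {U : Submodule F V // finrank F U = u} ×
      {L : Submodule F (Fin m → F) // finrank F L = u - 3}
    let D : I → Set (Fin m → LinearMap.BilinForm F V) := fun a => {b | skewSpan b a.1.1 ≤ a.2.1}
    have hBD : B ⟨u, hun⟩ ⊆ ⋃ a, D a := by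
      rintro b ⟨-, U, hU, L, hL, hb⟩
      exact Set.mem_iUnion.2 ⟨(⟨U, hU⟩, ⟨L, hL⟩), hb⟩
    have hD : ∀ a, (D a).ncard * q ^ (k * C) ≤ M ^ m := fun a =>
      ncard_skewSpan_le_mul a.1.2 (by rw [a.2.2]; omega) hC
    have h := ncard_mul_le_of_subset_iUnion hBD hD
    obtain ⟨e, hI, he⟩ : ∃ e, Nat.card I ≤ q ^ e ∧ e + (n - 21) ≤ k * C := by
      obtain ⟨u, rfl⟩ : ∃ v, u = v + 4 := ⟨u - 4, by omega⟩
      simp only [show u + 4 - 1 = u + 3 from rfl] at hC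
      -- Up to half the dimension, U and L are counted by spanning vectors; beyond it, by defining
      -- equations.
      rcases le_or_gt (2 * (u + 4)) n with h2 | h2
      · refine ⟨n * (u + 4) + m * (u + 1), ?_, ?_⟩
        · rw [Nat.card_prod, pow_add]
          refine Nat.mul_le_mul ?_ ?_
          · have := card_finrank_eq_le (F := F) (V := V) (u + 4)
            rwa [hn] at this
          · have := card_finrank_eq_le (F := F) (V := Fin m → F) (u + 1)
            rwa [finrank_fin_fun] at this
        · suffices 2 * (n * (u + 4) + m * (u + 1) + (n - 21)) ≤ 2 * (k * C) by omega
          rw [mul_left_comm, hC]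
          obtain ⟨r, rfl⟩ : ∃ r, n = r + 21 := ⟨n - 21, by omega⟩
          have hr : r + 21 - 21 = r := by omega
          rw [hr]
          zify at *
          have hm' : (m : ℤ) = r + 18 := by linarith
          have hk' : (k : ℤ) = r + 17 - u := by linarith
          rw [hm', hk']
          -- This product is exactly the difference of the two sides; it vanishes at u = 0, that is,
          -- in dimension 4.
          have : 0 ≤ (u : ℤ) * ((r + 21) * (u + 3) - ((u + 4) ^ 2 + 3 * (u + 4) + 6)) := by
            refine mul_nonneg (by positivity) ?_
            nlinarith
          nlinarith
      · refine ⟨n * k + m * k, ?_, ?_⟩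
        · rw [Nat.card_prod, pow_add]
          refine Nat.mul_le_mul ?_ ?_
          · have := card_finrank_eq_le_of_codim (F := F) (V := V) (u := u + 4) (k := k)
              (by rw [hn]; omega)
            rwa [hn] at this
          · have := card_finrank_eq_le_of_codim (F := F) (V := Fin m → F) (u := u + 1) (k := k)
              (by rw [finrank_fin_fun]; omega)
            rwa [finrank_fin_fun] at this
        · have hk1 : 1 ≤ k := by omega
          have h6 : 3 * n ≤ C := by nlinarith
          calc n * k + m * k + (n - 21) ≤ n * k + n * k + n * k := by
                have : m * k ≤ n * k := Nat.mul_le_mul_right _ (by omega)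
                have : n ≤ n * k := Nat.le_mul_of_pos_right _ hk1
                omega
            _ = k * (3 * n) := by ring
            _ ≤ k * C := Nat.mul_le_mul_left _ h6
    refine Nat.le_of_mul_le_mul_right (c := q ^ e) ?_ (by positivity)
    rw [mul_comm (M ^ m)]
    refine le_trans ?_ (h.trans (Nat.mul_le_mul_right _ hI))
    rw [mul_assoc, ← pow_add]
    exact Nat.mul_le_mul_left _ (Nat.pow_le_pow_right hq0 (by omega))
  have := ncard_mul_le_of_subset_iUnion hcov hB
  simpa using this

end FirstMoment

/-! ### Combining the estimates -/

section Existence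

variable {F V : Type*} [Field F] [AddCommGroup V] [Module F V] [Module.Finite F V]
variable [Finite F] [Finite V]

/-- For most tuples of forms, few extensions by one more form are deficient. -/
theorem ncard_often_deficient_le {w n : ℕ} (hn : finrank F V = n) (hw : w + 4 = n)
    (hn160 : 160 ≤ n) :
    {b : Fin w → LinearMap.BilinForm F V | Nat.card (LinearMap.BilinForm F V) ≤
      672 * {f | (Fin.cons f b : Fin (w + 1) → LinearMap.BilinForm F V) ∈
        deficientTuples F V (w + 1)}.ncard}.ncard * 2 ^ 79 ≤
      672 * Nat.card (LinearMap.BilinForm F V) ^ w := by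
  classical
  have := finite_bilinForm (F := F) (V := V)
  have := Fintype.ofFinite (LinearMap.BilinForm F V)
  set M := Nat.card (LinearMap.BilinForm F V) with hM
  have hM0 : 0 < M := Nat.card_pos
  set q := Nat.card F with hq
  have hq2 : 2 ≤ q := Finite.one_lt_card
  set A := {b : Fin w → LinearMap.BilinForm F V | M ≤
      672 * {f | (Fin.cons f b : Fin (w + 1) → LinearMap.BilinForm F V) ∈
        deficientTuples F V (w + 1)}.ncard} with hA
  -- Averaging over the first w components: each member of `A` accounts for at least M/672 deficient
  -- extensions.
  have hfib : A.ncard * M ≤ 672 * (deficientTuples F V (w + 1)).ncard := by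
    have hinj : Nat.card ((b : A) × {f | (Fin.cons f b.1 : Fin (w + 1) → LinearMap.BilinForm F V) ∈
        deficientTuples F V (w + 1)}) ≤ Nat.card (deficientTuples F V (w + 1)) := by
      refine Nat.card_le_card_of_injective (fun a => ⟨Fin.cons a.2.1 a.1.1, a.2.2⟩) ?_
      rintro ⟨⟨b, hb⟩, f, hf⟩ ⟨⟨b', hb'⟩, f', hf'⟩ h
      have h' : (Fin.cons f b : Fin (w + 1) → LinearMap.BilinForm F V) = Fin.cons f' b' :=
        congrArg Subtype.val h
      obtain ⟨rfl, rfl⟩ := Fin.cons_injective2 h'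
      rfl
    have := Fintype.ofFinite A
    rw [Nat.card_sigma, Nat.card_coe_set_eq] at hinj
    calc A.ncard * M = ∑ _b : A, M := by
          rw [Finset.sum_const, Finset.card_univ, ← Nat.card_eq_fintype_card, Nat.card_coe_set_eq,
            smul_eq_mul]
      _ ≤ ∑ b : A, 672 * Nat.card {f | (Fin.cons f b.1 : Fin (w + 1) → LinearMap.BilinForm F V) ∈
          deficientTuples F V (w + 1)} :=
          Finset.sum_le_sum fun b _ => by rw [Nat.card_coe_set_eq]; exact b.2
      _ ≤ _ := by rw [← Finset.mul_sum]; exact Nat.mul_le_mul_left _ hinj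
  have hdef := ncard_deficientTuples_le (F := F) hn (m := w + 1) (by omega) hn160
  have hpow : n * 2 ^ 79 ≤ q ^ (n - 21) := by
    refine le_trans ?_ (Nat.pow_le_pow_left hq2 _)
    obtain ⟨j, rfl⟩ : ∃ j, n = j + 110 := ⟨n - 110, by omega⟩
    have hj : j < 2 ^ j := Nat.lt_two_pow_self
    rw [show j + 110 - 21 = j + 10 + 79 by omega, pow_add, pow_add]
    refine Nat.mul_le_mul_right _ ?_
    omega
  have hn0 : 0 < n := by omega
  refine Nat.le_of_mul_le_mul_right (c := n * M) ?_ (by positivity)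
  calc A.ncard * 2 ^ 79 * (n * M) = A.ncard * M * (n * 2 ^ 79) := by ring
    _ ≤ 672 * (deficientTuples F V (w + 1)).ncard * q ^ (n - 21) := Nat.mul_le_mul hfib hpow
    _ = 672 * ((deficientTuples F V (w + 1)).ncard * q ^ (n - 21)) := by ring
    _ ≤ 672 * (n * M ^ (w + 1)) := Nat.mul_le_mul_left _ hdef
    _ = 672 * M ^ w * (n * M) := by ring

/-- There is an alternating map from dimension `n` to dimension `n - 3` such that the values on any
proper subspace of dimension `u` span a space of dimension at least `u - 2`. -/
theorem exists_finrank_le_finrank_skewSpan {m : ℕ} (hm : m + 3 = finrank F V)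
    (hn160 : 160 ≤ finrank F V) :
    ∃ b : Fin m → LinearMap.BilinForm F V, ∀ U : Submodule F V, U ≠ ⊤ →
      finrank F U ≤ finrank F (skewSpan b U) + 2 := by
  classical
  have := finite_bilinForm (F := F) (V := V)
  obtain ⟨w, rfl⟩ : ∃ w, m = w + 1 := ⟨m - 1, by omega⟩
  have hw : w + 4 = finrank F V := by omega
  have h1 := ncard_large_isotropicThree_le (F := F) (V := V) hw
  have h2 := ncard_dependentTuples_le (F := F) (V := V) hw (by omega)
  have h3 := ncard_often_deficient_le (F := F) (V := V) rfl hw hn160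
  set M := Nat.card (LinearMap.BilinForm F V) with hM
  have hM0 : 0 < M := Nat.card_pos
  set A := {b : Fin w → LinearMap.BilinForm F V |
        61 * Nat.card F ^ 3 < 20 * (isotropicThree b).card} with hA
  set B := {b : Fin w → LinearMap.BilinForm F V | M ≤
      672 * {f | (Fin.cons f b : Fin (w + 1) → LinearMap.BilinForm F V) ∈
        deficientTuples F V (w + 1)}.ncard} with hB
  have h2' : (dependentTuples F V w).ncard * 2 ^ 72 ≤ 15 * M ^ w :=
    (Nat.mul_le_mul_left _ (Nat.pow_le_pow_left Finite.one_lt_card 72)).trans h2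
  -- The proportions 1280/1281, 15/2^72 and 672/2^79 add up to less than 1.
  have hlt : (A ∪ dependentTuples F V w ∪ B).ncard < M ^ w := by
    have hu1 := Set.ncard_union_le (A ∪ dependentTuples F V w) B
    have hu2 := Set.ncard_union_le A (dependentTuples F V w)
    have hN : 0 < M ^ w := by positivity
    omega
  obtain ⟨b, hb⟩ : ∃ b, b ∉ A ∪ dependentTuples F V w ∪ B := by
    by_contra! h
    rw [Set.eq_univ_of_forall h, Set.ncard_univ, Nat.card_fun, Nat.card_fin] at hlt
    exact lt_irrefl _ hlt
  simp only [Set.mem_union, not_or] at hb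
  obtain ⟨⟨hbA, hbD⟩, hbB⟩ := hb
  have hE := card_le_mul_ncard_forall_notMem_symmOn (𝒰 := isotropicThree b)
    (fun T hT hT5 => frameIndep_of_notMem_dependentTuples hbD T hT hT5)
    (by simpa [hA] using hbA)
  rw [hB, Set.mem_ofPred_eq, not_le] at hbB
  -- At least M/672 forms avoid all isotropic three-spaces, while strictly fewer than M/672 give a
  -- deficient extension.
  obtain ⟨f, hfE, hfG⟩ : ∃ f, f ∈ {f : LinearMap.BilinForm F V | ∀ U ∈ isotropicThree b,
      f ∉ symmOn U} ∧ f ∉ {f | (Fin.cons f b : Fin (w + 1) → LinearMap.BilinForm F V) ∈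
        deficientTuples F V (w + 1)} := by
    by_contra! h
    have := Set.ncard_le_ncard (fun f hf => h f hf) (Set.toFinite _)
    omega
  refine ⟨Fin.cons f b, fun U hU => ?_⟩
  have hUn : finrank F U < finrank F V := Submodule.finrank_lt hU
  by_contra! hlt
  have hU3 : 3 ≤ finrank F U := by omega
  rcases hU3.eq_or_lt with hU3 | hU4
  · have hbot : skewSpan (Fin.cons f b : Fin (w + 1) → LinearMap.BilinForm F V) U = ⊥ :=
      Submodule.finrank_eq_zero.1 (by omega)
    have hsym : ∀ i, (Fin.cons f b : Fin (w + 1) → LinearMap.BilinForm F V) i ∈ symmOn U := by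
      intro i x hx y hy
      have hmem : (fun i => (Fin.cons f b : Fin (w + 1) → LinearMap.BilinForm F V) i x y -
          (Fin.cons f b : Fin (w + 1) → LinearMap.BilinForm F V) i y x) ∈
          skewSpan (Fin.cons f b : Fin (w + 1) → LinearMap.BilinForm F V) U :=
        Submodule.subset_span ⟨x, hx, y, hy, rfl⟩
      rw [hbot, Submodule.mem_bot] at hmem
      exact sub_eq_zero.1 (congrFun hmem i)
    exact hfE U (mem_isotropicThree.2 ⟨hU3.symm, fun i => by simpa using hsym i.succ⟩)
      (by simpa using hsym 0)
  · exact hfG ⟨U, hU4, hUn, by omega⟩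

end Existence

/-! ### Central extensions and ab-maximality -/

section TwistedProduct

theorem nsmul_eq_zero_of_dvd {p : ℕ} {M : Type*} [AddCommGroup M] [Module (ZMod p) M] {k : ℕ}
    (h : p ∣ k) (x : M) : k • x = 0 := by
  rw [← Nat.cast_smul_eq_nsmul (ZMod p), (ZMod.natCast_eq_zero_iff k p).2 h, zero_smul]

variable {p : ℕ} {V W : Type*} [AddCommGroup V] [Module (ZMod p) V]
  [AddCommGroup W] [Module (ZMod p) W]

/-- The central extension of `V` by `W` with the bilinear cocycle `b`. -/
@[ext]
structure TwistedProduct (b : V →ₗ[ZMod p] V →ₗ[ZMod p] W) where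
  fst : V
  snd : W

namespace TwistedProduct

open scoped commutatorElement

variable {b : V →ₗ[ZMod p] V →ₗ[ZMod p] W}

instance : Mul (TwistedProduct b) := ⟨fun g h => ⟨g.fst + h.fst, g.snd + h.snd + b g.fst h.fst⟩⟩
instance : One (TwistedProduct b) := ⟨⟨0, 0⟩⟩
instance : Inv (TwistedProduct b) := ⟨fun g => ⟨-g.fst, -g.snd + b g.fst g.fst⟩⟩

@[simp] theorem fst_mul (g h : TwistedProduct b) : (g * h).fst = g.fst + h.fst := rfl
@[simp] theorem snd_mul (g h : TwistedProduct b) :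
    (g * h).snd = g.snd + h.snd + b g.fst h.fst := rfl
@[simp] theorem fst_one : (1 : TwistedProduct b).fst = 0 := rfl
@[simp] theorem snd_one : (1 : TwistedProduct b).snd = 0 := rfl
@[simp] theorem fst_inv (g : TwistedProduct b) : g⁻¹.fst = -g.fst := rfl
@[simp] theorem snd_inv (g : TwistedProduct b) : g⁻¹.snd = -g.snd + b g.fst g.fst := rfl

instance : Group (TwistedProduct b) :=
  Group.ofLeftAxioms
    (fun g h k => by ext <;> simp <;> abel)
    (fun g => by ext <;> simp)
    (fun g => by ext <;> simp)

/-- The bijection with the product. -/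
def equivProd : TwistedProduct b ≃ V × W where
  toFun g := (g.fst, g.snd)
  invFun a := ⟨a.1, a.2⟩
  left_inv _ := rfl
  right_inv _ := rfl

instance [Finite V] [Finite W] : Finite (TwistedProduct b) := Finite.of_equiv _ equivProd.symm

theorem commutatorElement_eq (g h : TwistedProduct b) :
    ⁅g, h⁆ = ⟨0, b g.fst h.fst - b h.fst g.fst⟩ := by
  rw [commutatorElement_def, mul_assoc (g * h), ← mul_inv_rev, mul_inv_eq_iff_eq_mul]
  ext
  · simp [add_comm]
  · simp
    abel

theorem pow_eq (g : TwistedProduct b) (k : ℕ) :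
    g ^ k = ⟨k • g.fst, k • g.snd + k.choose 2 • b g.fst g.fst⟩ := by
  induction k with
  | zero => ext <;> simp
  | succ k ih =>
    rw [pow_succ, ih]
    ext
    · simp [add_smul]
    · have hc : (k + 1).choose 2 = k + k.choose 2 := by
        rw [Nat.choose_succ_succ' k 1, Nat.choose_one_right]
      simp only [snd_mul, hc, add_smul, one_smul, map_nsmul, LinearMap.smul_apply]
      abel

/-- The projection of a subgroup to `V`. -/
def proj (H : Subgroup (TwistedProduct b)) : Submodule (ZMod p) V :=
  AddSubgroup.toZModSubmodule p
    { carrier := {v | ∃ g ∈ H, g.fst = v}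
      add_mem' := by
        rintro _ _ ⟨g, hg, rfl⟩ ⟨h, hh, rfl⟩
        exact ⟨g * h, H.mul_mem hg hh, rfl⟩
      zero_mem' := ⟨1, H.one_mem, rfl⟩
      neg_mem' := by
        rintro _ ⟨g, hg, rfl⟩
        exact ⟨g⁻¹, H.inv_mem hg, rfl⟩ }

theorem mem_proj {H : Subgroup (TwistedProduct b)} {v : V} :
    v ∈ proj H ↔ ∃ g ∈ H, g.fst = v := Iff.rfl

/-- The intersection of a subgroup with `W`. -/
def central (H : Subgroup (TwistedProduct b)) : Submodule (ZMod p) W :=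
  AddSubgroup.toZModSubmodule p
    { carrier := {w | (⟨0, w⟩ : TwistedProduct b) ∈ H}
      add_mem' := by
        intro v w hv hw
        have heq : (⟨0, v + w⟩ : TwistedProduct b) = ⟨0, v⟩ * ⟨0, w⟩ := by ext <;> simp
        rw [Set.mem_ofPred_eq, heq]
        exact H.mul_mem hv hw
      zero_mem' := H.one_mem
      neg_mem' := by
        intro w hw
        have heq : (⟨0, -w⟩ : TwistedProduct b) = (⟨0, w⟩)⁻¹ := by ext <;> simp
        rw [Set.mem_ofPred_eq, heq]
        exact H.inv_mem hw }

theorem mem_central {H : Subgroup (TwistedProduct b)} {w : W} :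
    w ∈ central H ↔ (⟨0, w⟩ : TwistedProduct b) ∈ H := Iff.rfl

variable (b) in
/-- The span of the commutators of elements over `U`. -/
def commutatorSpan (U : Submodule (ZMod p) V) : Submodule (ZMod p) W :=
  Submodule.span (ZMod p) {w | ∃ x ∈ U, ∃ y ∈ U, w = b x y - b y x}

theorem commutatorSpan_mono {U U' : Submodule (ZMod p) V} (h : U ≤ U') :
    commutatorSpan b U ≤ commutatorSpan b U' := by
  refine Submodule.span_mono ?_
  rintro _ ⟨x, hx, y, hy, rfl⟩
  exact ⟨x, h hx, y, h hy, rfl⟩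

theorem commutatorSpan_proj_le (H : Subgroup (TwistedProduct b)) :
    commutatorSpan b (proj H) ≤ central ⁅H, H⁆ := by
  refine Submodule.span_le.2 ?_
  rintro _ ⟨_, ⟨g, hg, rfl⟩, _, ⟨h, hh, rfl⟩, rfl⟩
  have := Subgroup.commutator_mem_commutator hg hh
  rwa [commutatorElement_eq] at this

theorem eq_top_of_proj_of_central {H : Subgroup (TwistedProduct b)} (h1 : proj H = ⊤)
    (h2 : central H = ⊤) : H = ⊤ := by
  rw [eq_top_iff]
  rintro g -
  obtain ⟨h, hh, hhg⟩ := mem_proj.1 (h1 ▸ Submodule.mem_top : g.fst ∈ proj H)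
  have hc := mem_central.1 (h2 ▸ Submodule.mem_top : g.snd - h.snd ∈ central H)
  have := H.mul_mem hh hc
  convert this using 1
  ext <;> simp [hhg]

theorem card_subgroup_le [Finite V] [Finite W] (H : Subgroup (TwistedProduct b)) :
    Nat.card H ≤ Nat.card (proj H) * Nat.card W := by
  rw [← Nat.card_prod]
  refine Nat.card_le_card_of_injective
    (fun g : H => ((⟨g.1.fst, g.1, g.2, rfl⟩ : proj H), g.1.snd)) fun g h hgh => ?_
  rw [Prod.mk.injEq] at hgh
  exact Subtype.ext (TwistedProduct.ext (congrArg Subtype.val hgh.1) hgh.2)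

theorem card_commutatorSpan_le [Finite V] [Finite W] (H : Subgroup (TwistedProduct b)) :
    Nat.card (commutatorSpan b (proj H)) ≤ Nat.card (_root_.commutator H) := by
  have h1 : Nat.card (_root_.commutator H) = Nat.card (⁅H, H⁆ : Subgroup (TwistedProduct b)) := by
    rw [← Subgroup.map_subtype_commutator]
    exact Nat.card_congr
      ((_root_.commutator H).equivMapOfInjective _ H.subtype_injective).toEquiv
  rw [h1]
  refine Nat.card_le_card_of_injective
    (fun w => ⟨⟨0, w.1⟩, mem_central.1 (commutatorSpan_proj_le H w.2)⟩) fun v w h => ?_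
  simp only [Subtype.mk.injEq, TwistedProduct.mk.injEq, true_and] at h
  exact Subtype.ext h

/-- The derived subgroup contains the span of the commutators over the projection, and |H| is at
most the size of the projection times |W|. -/
theorem index_commutator_mul_le [Finite V] [Finite W] (H : Subgroup (TwistedProduct b)) :
    (_root_.commutator H).index * Nat.card (commutatorSpan b (proj H)) ≤
      Nat.card (proj H) * Nat.card W :=
  (Nat.mul_le_mul_left _ (card_commutatorSpan_le H)).trans
    ((Subgroup.index_mul_card _).le.trans (card_subgroup_le H))

theorem card_commutator [Finite V] [Finite W] (hb : commutatorSpan b ⊤ = ⊤) :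
    Nat.card (_root_.commutator (TwistedProduct b)) = Nat.card W := by
  have hfst : ∀ g ∈ _root_.commutator (TwistedProduct b), g.fst = 0 := by
    let K : Subgroup (TwistedProduct b) :=
      { carrier := {g | g.fst = 0}
        mul_mem' := fun {g h} hg hh => by
          rw [Set.mem_ofPred_eq] at *
          simp [hg, hh]
        one_mem' := rfl
        inv_mem' := fun {g} hg => by
          rw [Set.mem_ofPred_eq] at *
          simp [hg] }
    have : _root_.commutator (TwistedProduct b) ≤ K := by
      rw [commutator_def, Subgroup.commutator_le]
      intro g _ h _
      rw [commutatorElement_eq]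
      rfl
    exact fun g hg => this hg
  have hproj : proj (⊤ : Subgroup (TwistedProduct b)) = ⊤ := by
    rw [eq_top_iff]
    exact fun v _ => mem_proj.2 ⟨⟨v, 0⟩, trivial, rfl⟩
  have hmem : ∀ w : W, (⟨0, w⟩ : TwistedProduct b) ∈ _root_.commutator (TwistedProduct b) := by
    intro w
    have h := commutatorSpan_proj_le (⊤ : Subgroup (TwistedProduct b))
    rw [hproj, hb] at h
    exact mem_central.1 (h (Submodule.mem_top : w ∈ ⊤))
  refine Nat.card_congr
    { toFun := fun g => g.1.snd
      invFun := fun w => ⟨⟨0, w⟩, hmem w⟩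
      left_inv := fun g => Subtype.ext (TwistedProduct.ext (hfst g.1 g.2).symm rfl)
      right_inv := fun w => rfl }

end TwistedProduct

variable [Fact p.Prime] [Module.Finite (ZMod p) V] [Module.Finite (ZMod p) W]
  {b : V →ₗ[ZMod p] V →ₗ[ZMod p] W}

open TwistedProduct

/-- Already a hyperplane has commutator span of dimension at least (n - 1) - 2 = dim W. -/
theorem commutatorSpan_top_eq_top
    (hW : finrank (ZMod p) W + 3 = finrank (ZMod p) V)
    (hb : ∀ U : Submodule (ZMod p) V, U ≠ ⊤ →
      finrank (ZMod p) U ≤ finrank (ZMod p) (commutatorSpan b U) + 2) :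
    commutatorSpan b ⊤ = ⊤ := by
  obtain ⟨U, -, hU⟩ := (⊥ : Submodule (ZMod p) V).exists_ge_finrank_eq
    (l := finrank (ZMod p) V - 1) (by simp) (by omega)
  have hne : U ≠ ⊤ := by
    rintro rfl
    rw [finrank_top] at hU
    omega
  have h1 := hb U hne
  have h2 := Submodule.finrank_mono (commutatorSpan_mono (b := b) (le_top : U ≤ ⊤))
  have h3 := (commutatorSpan b ⊤).finrank_le
  exact Submodule.eq_top_of_finrank_eq (by omega)

theorem TwistedProduct.isAbMaximal [Finite V] [Finite W]
    (hW : finrank (ZMod p) W + 3 = finrank (ZMod p) V)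
    (hb : ∀ U : Submodule (ZMod p) V, U ≠ ⊤ →
      finrank (ZMod p) U ≤ finrank (ZMod p) (commutatorSpan b U) + 2)
    (hindex : (_root_.commutator (TwistedProduct b)).index = p ^ finrank (ZMod p) V) :
    IsAbMaximal (TwistedProduct b) := by
  have htop := commutatorSpan_top_eq_top hW hb
  have hp : 1 < p := (Fact.out : p.Prime).one_lt
  intro H hH
  -- A subgroup projecting onto V has all of W among its commutators, so it is the whole group.
  have hU : proj H ≠ ⊤ := by
    intro h
    refine hH (eq_top_of_proj_of_central h ?_)
    have h1 := commutatorSpan_proj_le H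
    rw [h, htop, top_le_iff] at h1
    rw [eq_top_iff, ← h1]
    exact fun w hw => Subgroup.commutator_le_self H hw
  have h2 := hb _ hU
  have h3 := index_commutator_mul_le H
  rw [Module.natCard_eq_pow_finrank (K := ZMod p) (V := commutatorSpan b (proj H)),
    Module.natCard_eq_pow_finrank (K := ZMod p) (V := proj H),
    Module.natCard_eq_pow_finrank (K := ZMod p) (V := W), Nat.card_zmod, ← pow_add] at h3
  rw [hindex]
  have h4 : (_root_.commutator H).index ≤ p ^ (finrank (ZMod p) W + 2) := by
    refine Nat.le_of_mul_le_mul_right (h3.trans ?_)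
      (by positivity : 0 < p ^ finrank (ZMod p) (commutatorSpan b (proj H)))
    rw [← pow_add]
    exact Nat.pow_le_pow_right hp.le (by omega)
  exact h4.trans_lt (Nat.pow_lt_pow_right hp (by omega))

omit [Module.Finite (ZMod p) V] [Module.Finite (ZMod p) W] in
-- The cocycle contributes `p.choose 2` copies of b(v,v), and p divides this coefficient exactly
-- when p is odd.
theorem TwistedProduct.pow_prime_eq_one (hp2 : p ≠ 2) (g : TwistedProduct b) : g ^ p = 1 := by
  have hp : p.Prime := Fact.out
  have h2 : p ∣ p.choose 2 :=
    hp.dvd_choose_self two_ne_zero (lt_of_le_of_ne hp.two_le (Ne.symm hp2))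
  rw [pow_eq, nsmul_eq_zero_of_dvd dvd_rfl, nsmul_eq_zero_of_dvd dvd_rfl, nsmul_eq_zero_of_dvd h2,
    add_zero]
  rfl

end TwistedProduct

/-! ### The groups and the consequences -/

/-- For every prime `p` and `n ≥ 160` there is an ab-maximal `p`-group with abelianization of order
`p ^ n` and derived subgroup of order `p ^ (n - 3)`. -/
theorem exists_isAbMaximal {p : ℕ} (hp : p.Prime) {n : ℕ} (hn : 160 ≤ n) :
    ∃ (G : Type) (_ : Group G) (_ : Finite G),
      IsPGroup p G ∧ IsAbMaximal G ∧ (p ≠ 2 → Monoid.exponent G = p) ∧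
      (commutator G).index = p ^ n ∧ Nat.card (commutator G) = p ^ (n - 3) := by
  have : Fact p.Prime := ⟨hp⟩
  obtain ⟨c, hc⟩ := exists_finrank_le_finrank_skewSpan (F := ZMod p) (V := Fin n → ZMod p)
    (m := n - 3) (by rw [finrank_fin_fun]; omega) (by rwa [finrank_fin_fun])
  let b : (Fin n → ZMod p) →ₗ[ZMod p] (Fin n → ZMod p) →ₗ[ZMod p] (Fin (n - 3) → ZMod p) :=
    LinearMap.mk₂ (ZMod p) (fun x y i => c i x y)
      (fun x x' y => by ext; simp) (fun a x y => by ext; simp)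
      (fun x y y' => by ext; simp) (fun a x y => by ext; simp)
  have hb : ∀ U : Submodule (ZMod p) (Fin n → ZMod p), U ≠ ⊤ →
      finrank (ZMod p) U ≤ finrank (ZMod p) (TwistedProduct.commutatorSpan b U) + 2 := hc
  have hW : finrank (ZMod p) (Fin (n - 3) → ZMod p) + 3 = finrank (ZMod p) (Fin n → ZMod p) := by
    rw [finrank_fin_fun, finrank_fin_fun]; omega
  have hcomm : Nat.card (commutator (TwistedProduct b)) = p ^ (n - 3) := by
    rw [TwistedProduct.card_commutator (commutatorSpan_top_eq_top hW hb), Nat.card_fun]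
    simp
  have hcard : Nat.card (TwistedProduct b) = p ^ (n + (n - 3)) := by
    rw [Nat.card_congr TwistedProduct.equivProd, Nat.card_prod, Nat.card_fun, Nat.card_fun, pow_add]
    simp
  have hindex : (commutator (TwistedProduct b)).index = p ^ n := by
    have h := (commutator (TwistedProduct b)).index_mul_card
    rw [hcomm, hcard, pow_add] at h
    exact Nat.eq_of_mul_eq_mul_right (pow_pos hp.pos _) h
  refine ⟨TwistedProduct b, inferInstance, inferInstance, IsPGroup.of_card hcard,
    TwistedProduct.isAbMaximal hW hb (by rw [hindex, finrank_fin_fun]), fun hp2 => ?_,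
    hindex, hcomm⟩
  refine ((Nat.dvd_prime hp).1 (Monoid.exponent_dvd_of_forall_pow_eq_one
    (TwistedProduct.pow_prime_eq_one hp2))).resolve_left fun h1 => ?_
  rw [Monoid.exp_eq_one_iff] at h1
  have := Nat.card_of_subsingleton (1 : TwistedProduct b)
  rw [hcard] at this
  exact (Nat.one_lt_pow (by omega) hp.one_lt).ne' this

theorem exists_isExtremalAbMaximal {p : ℕ} (hp : p.Prime) {n : ℕ} (hn : 160 ≤ n) :
    ∃ (G : Type) (_ : Group G) (_ : Finite G),
      IsExtremalAbMaximal p G ∧ Nat.card G = p ^ (2 * n - 3) := by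
  obtain ⟨G, hG, hfin, hpG, hab, -, hindex, hcomm⟩ := exists_isAbMaximal hp hn
  refine ⟨G, hG, hfin, ⟨hpG, fun h => ?_, hab, ?_⟩, ?_⟩
  · have hbot : commutator G = ⊥ := by
      rw [commutator_def, Subgroup.commutator_eq_bot_iff_le_centralizer]
      exact fun g _ => Subgroup.mem_centralizer_iff.2 fun x _ => h x g
    rw [hbot, Subgroup.card_bot] at hcomm
    exact (Nat.one_lt_pow (by omega) hp.one_lt).ne hcomm
  · rw [hindex, hcomm, ← pow_add]
    congr 1
    omega
  · rw [← (commutator G).index_mul_card, hindex, hcomm, ← pow_add]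
    congr 1
    omega

theorem mul_le_of_two_pow_rpow_le {a c : ℕ} {δ : ℝ}
    (h : ((2 ^ a : ℕ) : ℝ) ^ δ ≤ ((2 ^ c : ℕ) : ℝ)) : (a : ℝ) * δ ≤ c := by
  rw [Nat.cast_pow, Nat.cast_pow, Nat.cast_ofNat, ← Real.rpow_natCast, ← Real.rpow_natCast,
    ← Real.rpow_mul zero_le_two] at h
  exact (Real.rpow_le_rpow_left_iff one_lt_two).1 h

theorem theorem1p1 :
    -- the groups
    (∀ p : ℕ, p.Prime → ∀ n : ℕ, 160 ≤ n →
      ∃ (G : Type) (_ : Group G) (_ : Finite G),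
        IsPGroup p G ∧ IsAbMaximal G ∧
        (p ≠ 2 → Monoid.exponent G = p) ∧
        (commutator G).index = p ^ n ∧
        Nat.card (commutator G) = p ^ (n - 3)) ∧
    -- for each prime, extremal groups occur with infinitely many orders
    (∀ p : ℕ, p.Prime →
      {m : ℕ | ∃ (G : Type) (_ : Group G) (_ : Finite G),
        IsExtremalAbMaximal p G ∧ Nat.card G = m}.Infinite) ∧
    -- no exponent above one half bounds the abelianization of all ab-maximal groups from below
    (¬ ∃ δ : ℝ, 1 / 2 < δ ∧
      ∀ (G : Type) [Group G] [Finite G], IsAbMaximal G →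
        (Nat.card G : ℝ) ^ δ ≤ ((commutator G).index : ℝ)) := by
  refine ⟨fun p hp n hn => exists_isAbMaximal hp hn, fun p hp => ?_, ?_⟩
  · refine Set.infinite_of_injective_forall_mem (f := fun k : ℕ => p ^ (2 * (k + 160) - 3)) ?_
      fun k => exists_isExtremalAbMaximal hp (by omega)
    intro k l h
    have : 2 * (k + 160) - 3 = 2 * (l + 160) - 3 := Nat.pow_right_injective hp.two_le h
    omega
  · rintro ⟨δ, hδ, h⟩
    -- For the 2-groups of order 2^(2n-3), the bound would give (2n - 3)δ ≤ n, that is, n(2δ - 1) ≤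
    -- 3δ.
    obtain ⟨k, hk⟩ := exists_nat_gt (3 * δ / (2 * δ - 1))
    have hδ' : 0 < 2 * δ - 1 := by linarith
    rw [div_lt_iff₀ hδ'] at hk
    obtain ⟨G, hG, hfin, -, hab, -, hindex, hcomm⟩ :=
      exists_isAbMaximal Nat.prime_two (n := k + 160) (by omega)
    have hG := h G hab
    rw [← (commutator G).index_mul_card, hindex, hcomm, ← pow_add,
      show k + 160 + (k + 160 - 3) = 2 * k + 317 by omega] at hG
    have := mul_le_of_two_pow_rpow_le hG
    push_cast at this
    linarith
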